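/- Let $d\ge 1$, $T>0$, and let $(\Omega,\mathcal A,\mathbb P)$ be a probability space. Let $\mathcal D=\mathcal C_0^\infty([0,\infty)\times\mathbb R^d)$ be the space of real smooth compactly supported functions, let $\mathcal F f(\xi)=\int_{\mathbb R^d}e^{-i\langle\xi,x\rangle}f(x)\,dx$, and let $W=\{W(\varphi),\ \varphi\in\mathcal D\}$ be a spatially homogeneous Gaussian noise with spectral measure $\mu$, that is, $\mu$ is a non-negative tempered measure on $\mathbb R^d$ and $W$ is a centered Gaussian process with $$\mathbb E[W(\varphi)W(\psi)]=\int_0^\infty\int_{\mathbb R^d}\mathcal F\varphi(t,\cdot)(\xi)\,\overline{\mathcal F\psi(t,\cdot)(\xi)}\,\mu(d\xi)\,dt,\qquad \varphi,\psi\in\mathcal D.$$ By $L^2(\Omega)$-continuity $W$ extends to the completion of $\mathcal D$ for this inner product; for $g$ in the completion the random variable $\int_0^\infty\int_{\mathbb R^d} g(t,x)\,W(dt,dx):=W(g)$ is the Wiener integral of $g$. Put $\mathcal F_t=\sigma(W(\mathbf 1_{[0,s]}\varphi),\ s\in[0,t],\ \varphi\in\mathcal D)\vee\mathcal N$ with $\mathcal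 N$ the family of $\mathbb P$-null sets, and $G_t(x)=(2\pi t)^{-d/2}e^{-|x|^2/(2t)}$ for $t>0$. Let $b:\mathbb R\to\mathbb R$ be bounded and globally Lipschitz, let $u_0:\mathbb R^d\to\mathbb R$ be bounded and measurable, and put $I_0(t,x)=(u_0*G_t)(x)$ for $t>0$, $I_0(0,x)=u_0(x)$. Suppose that for some $q\in(0,2)$ $$\int_{\mathbb R^d}\frac{\mu(d\xi)}{1+|\xi|^q}<\infty .$$ Let $u=\{u(t,x),\ (t,x)\in[0,T]\times\mathbb R^d\}$ be a mild solution of the stochastic heat equation $\partial_t u-\frac12\Delta u=b(u)+\dot W$, $u(0,\cdot)=u_0$, that is, an $(\mathcal F_t)$-adapted, jointly measurable process such that, for all $(t,x)\in[0,T]\times\mathbb R^d$, $\mathbb P$-almost surely, $$u(t,x)=I_0(t,x)+\int_0^t\int_{\mathbb R^d}G_{t-s}(x-y)\,W(ds,dy)+\int_0^t\big(b(u(s,\cdot))*G_{t-s}\big)(x)\,ds .$$ Then $u$ has a modification all of whose sample paths $(t,x)\mapsto u(t,x)$ are continuous on $(0,T]\times\mathbb R^d$ and, relative to $[0,T]\times\mathbb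 R^d$, at every point $(0,x)$ such that $u_0$ is continuous at $x$; moreover, the sample paths of this modification minus $I_0$ are continuous on the whole of $[0,T]\times\mathbb R^d$. In particular, if $u_0$ is continuous, the sample paths of the modification are continuous on $[0,T]\times\mathbb R^d$. -/

import Mathlib

open MeasureTheory ProbabilityTheory Filter Topology
open scoped ENNReal

namespace StochHeat

/-- The Euclidean space `ℝ^d`. -/
abbrev Space (d : ℕ) := EuclideanSpace ℝ (Fin d)

/-- A smooth compactly supported (real) test function on the closed half space `[0,∞) × ℝ^d`,
i.e. the restriction to `t ≥ 0` of a smooth compactly supported function on `ℝ × ℝ^d`.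
It is represented by its extension by zero to negative times, so that two test functions are equal
as soon as they agree on `[0,∞) × ℝ^d`. -/
structure TestFunction (d : ℕ) where
  /-- the values of the test function -/
  toFun : ℝ → Space d → ℝ
  zero_of_neg : ∀ t < 0, ∀ x, toFun t x = 0
  smooth : ∃ ψ : ℝ × Space d → ℝ, ContDiff ℝ (⊤ : ℕ∞) ψ ∧ HasCompactSupport ψ ∧
    ∀ t, 0 ≤ t → ∀ x, toFun t x = ψ (t, x)

/-- The Fourier transform `∫ e^{-i⟨ξ,x⟩} f(x) dx` of a function on `ℝ^d`. -/
noncomputable def fourier {d : ℕ} (f : Space d → ℝ) (ξ : Space d) : ℂ :=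
  ∫ x, Complex.exp (-(Complex.I * ((inner ℝ ξ x : ℝ) : ℂ))) * ((f x : ℝ) : ℂ)

/-- `W` is a spatially homogeneous Gaussian noise, white in time, with spectral measure `μ`:
a centered Gaussian process indexed by the test functions, with covariance
`E[W(φ) W(ψ)] = ∫_0^∞ ∫ Fφ(t,·)(ξ) conj (Fψ(t,·)(ξ)) μ(dξ) dt`, where `μ` is tempered. The
identity is one of complex numbers; its right-hand side is in particular real. -/
structure IsHomogeneousNoise {d : ℕ} {Ω : Type*} [MeasurableSpace Ω] (P : Measure Ω)
    (μ : Measure (Space d)) (W : TestFunction d → Ω → ℝ) : Prop where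
  tempered : μ.HasTemperateGrowth
  measurable : ∀ φ, Measurable (W φ)
  gaussian : IsGaussianProcess W P
  centered : ∀ φ, ∫ ω, W φ ω ∂P = 0
  covariance : ∀ φ ψ : TestFunction d,
    ((∫ ω, W φ ω * W ψ ω ∂P : ℝ) : ℂ) =
      ∫ t in Set.Ioi (0 : ℝ), ∫ ξ, fourier (φ.toFun t) ξ *
        (starRingEnd ℂ) (fourier (ψ.toFun t) ξ) ∂μ

/-- `X` is (a version of) the Wiener integral `∫_0^∞ ∫ g(t,x) W(dt,dx)`: the integrand `g` is the
limit of test functions `φ k` for the norm `(∫_0^∞ ∫ |Fg(t,·)(ξ)|² μ(dξ) dt)^{1/2}` of the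
completion of the space of test functions, and `X` is the limit of `W (φ k)` in `L²(Ω)`.
Such an `X` is unique up to almost sure equality and does not depend on the sequence. -/
def IsWienerIntegral {d : ℕ} {Ω : Type*} [MeasurableSpace Ω] (P : Measure Ω)
    (μ : Measure (Space d)) (W : TestFunction d → Ω → ℝ)
    (g : ℝ → Space d → ℝ) (X : Ω → ℝ) : Prop :=
  Measurable X ∧ (∀ᵐ t ∂volume.restrict (Set.Ioi (0 : ℝ)), Integrable (g t)) ∧
    ∃ φ : ℕ → TestFunction d,
      Tendsto (fun k => ∫⁻ t in Set.Ioi (0 : ℝ), ∫⁻ ξ,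
        ‖fourier ((φ k).toFun t) ξ - fourier (g t) ξ‖ₑ ^ 2 ∂μ) atTop (𝓝 0) ∧
      Tendsto (fun k => ∫⁻ ω, ‖W (φ k) ω - X ω‖ₑ ^ 2 ∂P) atTop (𝓝 0)

/-- The filtration generated by the noise, `F_t = σ(W(1_{[0,s]} φ), s ∈ [0,t], φ ∈ D) ∨ N`, with
`N` the family of null events. -/
noncomputable def noiseFiltration {d : ℕ} {Ω : Type*} [mΩ : MeasurableSpace Ω] (P : Measure Ω)
    (μ : Measure (Space d)) (W : TestFunction d → Ω → ℝ) : Filtration ℝ mΩ where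
  seq t := (⨆ X ∈ {X : Ω → ℝ | ∃ s ∈ Set.Icc 0 t, ∃ φ : TestFunction d,
      IsWienerIntegral P μ W (fun r x => (Set.Icc 0 s).indicator (fun r => φ.toFun r x) r) X},
      MeasurableSpace.comap X (borel ℝ)) ⊔
    MeasurableSpace.generateFrom {A : Set Ω | MeasurableSet A ∧ P A = 0}
  mono' := by
    intro t t' h
    refine sup_le_sup_right (biSup_mono ?_) _
    rintro X ⟨s, hs, φ, hX⟩
    exact ⟨s, ⟨hs.1, hs.2.trans h⟩, φ, hX⟩
  le' := by
    intro t
    refine sup_le (iSup₂_le ?_) (MeasurableSpace.generateFrom_le fun A hA => hA.1)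
    rintro X ⟨s, _, φ, hX⟩
    rw [← BorelSpace.measurable_eq (α := ℝ)]
    exact hX.1.comap_le

/-- The heat kernel `G_t(x) = (2πt)^{-d/2} e^{-|x|²/(2t)}`, used for `t > 0`. -/
noncomputable def heatKernel {d : ℕ} (t : ℝ) (x : Space d) : ℝ :=
  1 / (2 * Real.pi * t) ^ ((d : ℝ) / 2) * Real.exp (-(‖x‖ ^ 2 / (2 * t)))

/-- The solution `(u₀ * G_t)(x)` of the homogeneous heat equation with initial condition `u₀`
(at time `0`, where `G_0` is the Dirac mass at the origin, it is `u₀ x`). -/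
noncomputable def heatInit {d : ℕ} (u₀ : Space d → ℝ) (t : ℝ) (x : Space d) : ℝ :=
  if t = 0 then u₀ x else ∫ y, u₀ y * heatKernel t (x - y)

/-- The integrand `(s,y) ↦ 1_{[0,t)}(s) G_{t-s}(x-y)` of the stochastic convolution. -/
noncomputable def convIntegrand {d : ℕ} (t : ℝ) (x : Space d) (s : ℝ) (y : Space d) : ℝ :=
  if 0 ≤ s ∧ s < t then heatKernel (t - s) (x - y) else 0

/-- `u = {u(t,x), (t,x) ∈ [0,T] × ℝ^d}` is a mild solution of the stochastic heat equation
`∂_t u - ½ Δ u = b(u) + Ẇ` with `u(0,·) = u₀`: it is adapted and jointly measurable, and for all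
`(t,x) ∈ [0,T] × ℝ^d`, almost surely,
`u(t,x) = (u₀ * G_t)(x) + ∫_0^t ∫ G_{t-s}(x-y) W(ds,dy) + ∫_0^t (b(u(s)) * G_{t-s})(x) ds`.
Only the values of `u` at times in `[0,T]` matter. -/
structure IsMildSolution {d : ℕ} {Ω : Type*} [MeasurableSpace Ω] (P : Measure Ω)
    (μ : Measure (Space d)) (W : TestFunction d → Ω → ℝ) (T : ℝ) (b : ℝ → ℝ)
    (u₀ : Space d → ℝ) (u : ℝ → Space d → Ω → ℝ) : Prop where
  adapted : ∀ t ∈ Set.Icc 0 T, ∀ x, Measurable[noiseFiltration P μ W t] (u t x)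
  measurable : Measurable (fun p : Set.Icc 0 T × Space d × Ω => u p.1 p.2.1 p.2.2)
  mild : ∀ t ∈ Set.Icc 0 T, ∀ x, ∃ V : Ω → ℝ, IsWienerIntegral P μ W (convIntegrand t x) V ∧
    ∀ᵐ ω ∂P, u t x ω = heatInit u₀ t x + V ω +
      ∫ s in (0 : ℝ)..t, ∫ y, b (u s y ω) * heatKernel (t - s) (x - y)

/-- `u'` is a modification of the random field `u` on `[0,T] × ℝ^d`. -/
def IsModification {d : ℕ} {Ω : Type*} [MeasurableSpace Ω] (P : Measure Ω) (T : ℝ)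
    (u u' : ℝ → Space d → Ω → ℝ) : Prop :=
  ∀ t ∈ Set.Icc 0 T, ∀ x, Measurable (u' t x) ∧ ∀ᵐ ω ∂P, u' t x ω = u t x ω

end StochHeat

/-! The mild formulation writes `u` as a sum of three terms that are treated separately. The initial
term is deterministic: a Gaussian bound and dominated convergence give continuity at positive times,
while Brownian scaling, which rewrites it as an average of `u₀ (x - √t • z)` against a fixed
Gaussian, handles points of continuity at time zero. The drift is continuous for every `ω`, again by
dominated convergence, because `b` is bounded and the heat kernel has mass one. It is built from the
given `u`, so no fixed point is involved.

Only the stochastic convolution needs probability. On the Fourier side the kernel is `exp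
(-t‖ξ‖²/2)` times a phase. Moving the space-time parameter by `δ` changes it by a factor whose
square is at most a constant times `min (δ(1+‖ξ‖²)) 1`, hence times `(δ(1+‖ξ‖²))^η` for any `η ∈
[0,1]`, and integrating in time gains `1/(1+‖ξ‖²)`. With `η = 1 - q/2` there remains `δ^η
(1+‖ξ‖²)^(-q/2)`, which is integrable against `μ` by hypothesis
(`lintegral_spectralMeasure_convIntegrand_sub_le`).

This bounds second moments of increments. Gaussianity upgrades it to moments of order `2k` of size
`δ^(ηk)` (`lintegral_wienerIntegral_sub_pow_le`). Once `ηk ≥ d + 2`, the Kolmogorov–Chentsov theorem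
in dimension `d + 1`, proved here by dyadic chaining (`exists_continuous_modification`), yields a
continuous version. -/

namespace StochHeat

/-! ### Dyadic chaining and the Kolmogorov–Chentsov theorem -/

section Kolmogorov

variable {ι : Type*} [Fintype ι]

/-- The dyadic point `z / 2 ^ k`. -/
noncomputable def dyadicPoint (k : ℕ) (z : ι → ℤ) : ι → ℝ := fun i => (z i : ℝ) / 2 ^ k

/-- The integer coordinates of the dyadic point of level `k` below `p`. -/
noncomputable def dyadicFloor (k : ℕ) (p : ι → ℝ) : ι → ℤ := fun i => ⌊p i * 2 ^ k⌋

omit [Fintype ι] in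
lemma abs_dyadicFloor_le {R : ℕ} {p : ι → ℝ} (hp : ∀ i, |p i| ≤ R) (k : ℕ) (i : ι) :
    |dyadicFloor k p i| ≤ (R : ℤ) * 2 ^ k := by
  have h := abs_le.1 (hp i)
  have h2 : (0 : ℝ) < 2 ^ k := by positivity
  rw [abs_le]
  constructor
  · refine Int.le_floor.2 ?_
    push_cast
    nlinarith
  · have : ((dyadicFloor k p i : ℤ) : ℝ) ≤ ((R : ℤ) * 2 ^ k : ℤ) := by
      push_cast
      exact (Int.floor_le _).trans (by nlinarith)
    exact_mod_cast this

omit [Fintype ι] in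
-- Doubling the integer coordinates re-reads a level `k` point on the grid of level `k + 1`. Thus
-- consecutive approximations of one point are neighbours on the finer grid: this is the vertical
-- link of the chain.
lemma abs_two_mul_dyadicFloor_sub_le (k : ℕ) (p : ι → ℝ) (i : ι) :
    |2 * dyadicFloor k p i - dyadicFloor (k + 1) p i| ≤ 1 := by
  have h1 := Int.floor_le (p i * 2 ^ k)
  have h2 := Int.lt_floor_add_one (p i * 2 ^ k)
  have h3 := Int.floor_le (p i * 2 ^ (k + 1))
  have h4 := Int.lt_floor_add_one (p i * 2 ^ (k + 1))
  rw [pow_succ] at h3 h4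
  have e1 : ((2 * ⌊p i * 2 ^ k⌋ : ℤ) : ℝ) < (⌊p i * (2 ^ k * 2)⌋ + 1 : ℤ) := by
    push_cast; linarith
  have e2 : ((⌊p i * (2 ^ k * 2)⌋ : ℤ) : ℝ) < (2 * ⌊p i * 2 ^ k⌋ + 2 : ℤ) := by
    push_cast; linarith
  rw [Int.cast_lt] at e1 e2
  simp only [dyadicFloor, pow_succ]
  rw [abs_le]
  omega

omit [Fintype ι] in
-- The horizontal link of the chain: approximations of two close points are neighbours on the same
-- grid.
lemma abs_dyadicFloor_sub_le {k : ℕ} {p p' : ι → ℝ} (h : ∀ i, |p i - p' i| ≤ (1 / 2) ^ k) (i : ι) :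
    |dyadicFloor k p' i - dyadicFloor k p i| ≤ 1 := by
  have h0 : (0 : ℝ) < 2 ^ k := by positivity
  have h' : |p i * 2 ^ k - p' i * 2 ^ k| ≤ 1 := by
    rw [← sub_mul, abs_mul, abs_of_pos h0]
    calc _ ≤ (1 / 2 : ℝ) ^ k * 2 ^ k := by gcongr; exact h i
      _ = 1 := by rw [← mul_pow]; norm_num
  have h1 := Int.floor_le (p i * 2 ^ k)
  have h2 := Int.lt_floor_add_one (p i * 2 ^ k)
  have h3 := Int.floor_le (p' i * 2 ^ k)
  have h4 := Int.lt_floor_add_one (p' i * 2 ^ k)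
  obtain ⟨h5, h6⟩ := abs_le.1 h'
  have e1 : ((⌊p i * 2 ^ k⌋ : ℤ) : ℝ) < (⌊p' i * 2 ^ k⌋ + 2 : ℤ) := by
    push_cast; linarith
  have e2 : ((⌊p' i * 2 ^ k⌋ : ℤ) : ℝ) < (⌊p i * 2 ^ k⌋ + 2 : ℤ) := by
    push_cast; linarith
  rw [Int.cast_lt] at e1 e2
  simp only [dyadicFloor]
  rw [abs_le]
  omega

lemma dist_dyadicPoint_dyadicFloor_le (k : ℕ) (p : ι → ℝ) :
    dist (dyadicPoint k (dyadicFloor k p)) p ≤ (1 / 2) ^ k := by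
  refine (dist_pi_le_iff (by positivity)).2 fun i => ?_
  have h0 : (0 : ℝ) < 2 ^ k := by positivity
  have h1 := Int.floor_le (p i * 2 ^ k)
  have h2 := Int.lt_floor_add_one (p i * 2 ^ k)
  simp only [dyadicPoint, dyadicFloor, Real.dist_eq]
  have : ((⌊p i * 2 ^ k⌋ : ℤ) : ℝ) / 2 ^ k - p i = (⌊p i * 2 ^ k⌋ - p i * 2 ^ k) * (1 / 2) ^ k := by
    rw [one_div, inv_pow]; field_simp
  rw [this, abs_mul, abs_of_nonneg (by positivity : (0 : ℝ) ≤ (1 / 2) ^ k)]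
  refine mul_le_of_le_one_left (by positivity) (abs_le.2 ⟨by linarith, by linarith⟩)

lemma dist_dyadicPoint_add_le (k : ℕ) (z e : ι → ℤ) (he : ∀ i, |e i| ≤ 1) :
    dist (dyadicPoint k z) (dyadicPoint k (z + e)) ≤ (1 / 2) ^ k := by
  refine (dist_pi_le_iff (by positivity)).2 fun i => ?_
  simp only [dyadicPoint, Real.dist_eq, Pi.add_apply]
  have : (z i : ℝ) / 2 ^ k - ((z i + e i : ℤ) : ℝ) / 2 ^ k = - (e i : ℝ) * (1 / 2) ^ k := by
    rw [one_div, inv_pow]; push_cast; field_simp; ring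
  rw [this, abs_mul, abs_of_nonneg (by positivity : (0 : ℝ) ≤ (1 / 2) ^ k), abs_neg]
  refine mul_le_of_le_one_left (by positivity) ?_
  exact_mod_cast he i

/-- If the increments of `f` between neighbouring dyadic points of level `k` decay geometrically,
locally uniformly, then `f` along dyadic approximations converges to a continuous function. -/
lemma exists_continuous_tendsto_dyadic {f : (ι → ℝ) → ℝ}
    (hf : ∀ R : ℕ, ∃ K r : ℝ, 0 ≤ r ∧ r < 1 ∧ ∀ (k : ℕ) (z : ι → ℤ),
      (∀ i, |z i| ≤ (R : ℤ) * 2 ^ k) → ∀ e : ι → ℤ, (∀ i, |e i| ≤ 1) →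
        |f (dyadicPoint k z) - f (dyadicPoint k (z + e))| ≤ K * r ^ k) :
    ∃ g : (ι → ℝ) → ℝ, Continuous g ∧
      ∀ p, Tendsto (fun k => f (dyadicPoint k (dyadicFloor k p))) atTop (𝓝 (g p)) := by
  have step : ∀ R : ℕ, ∃ K r : ℝ, 0 ≤ K ∧ 0 ≤ r ∧ r < 1 ∧
      (∀ p : ι → ℝ, (∀ i, |p i| ≤ R) → ∀ k, dist (f (dyadicPoint k (dyadicFloor k p)))
        (f (dyadicPoint (k + 1) (dyadicFloor (k + 1) p))) ≤ K * r ^ k) ∧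
      (∀ p p' : ι → ℝ, (∀ i, |p i| ≤ R) → ∀ k, (∀ i, |p i - p' i| ≤ (1 / 2) ^ k) →
        dist (f (dyadicPoint k (dyadicFloor k p))) (f (dyadicPoint k (dyadicFloor k p')))
          ≤ K * r ^ k) := by
    intro R
    obtain ⟨K, r, hr0, hr1, h⟩ := hf R
    -- The bound at level zero for the trivial step `e = 0` reads `0 ≤ K`.
    have hK : 0 ≤ K := by
      have := h 0 0 (by simp) 0 (by simp)
      simpa using this
    refine ⟨K, r, hK, hr0, hr1, fun p hp k => ?_, fun p p' hp k hpp => ?_⟩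
    · have h1 := h (k + 1) (dyadicFloor (k + 1) p) (abs_dyadicFloor_le hp _)
        (fun i => 2 * dyadicFloor k p i - dyadicFloor (k + 1) p i)
        (abs_two_mul_dyadicFloor_sub_le k p)
      have h2 : dyadicPoint (k + 1) (dyadicFloor (k + 1) p +
          fun i => 2 * dyadicFloor k p i - dyadicFloor (k + 1) p i) =
          dyadicPoint k (dyadicFloor k p) := by
        funext i
        simp only [dyadicPoint, Pi.add_apply, add_sub_cancel]
        push_cast
        rw [pow_succ]
        field_simp
      rw [h2, abs_sub_comm] at h1
      refine h1.trans ?_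
      rw [pow_succ]
      have : 0 ≤ K * r ^ k := by positivity
      nlinarith
    · have h1 := h k (dyadicFloor k p) (abs_dyadicFloor_le hp _)
        (fun i => dyadicFloor k p' i - dyadicFloor k p i) (abs_dyadicFloor_sub_le hpp)
      have h2 : (dyadicFloor k p + fun i => dyadicFloor k p' i - dyadicFloor k p i) =
          dyadicFloor k p' := by
        funext i; simp
      rwa [h2] at h1
  have bd : ∀ p : ι → ℝ, ∀ i, |p i| ≤ (⌈‖p‖⌉₊ : ℕ) := fun p i =>
    (norm_le_pi_norm p i).trans (Nat.le_ceil _)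
  have hlim : ∀ p : ι → ℝ, ∃ a, Tendsto (fun k => f (dyadicPoint k (dyadicFloor k p))) atTop
      (𝓝 a) := by
    intro p
    obtain ⟨K, r, -, -, hr1, h, -⟩ := step ⌈‖p‖⌉₊
    exact cauchySeq_tendsto_of_complete (cauchySeq_of_le_geometric r K hr1 (h p (bd p)))
  choose g hg using hlim
  refine ⟨g, ?_, hg⟩
  rw [continuous_iff_continuousAt]
  intro p
  -- The extra unit in the box leaves room for every `p'` within `(1/2)^k ≤ 1` of `p`.
  obtain ⟨K, r, hK, hr0, hr1, h, h'⟩ := step (⌈‖p‖⌉₊ + 1)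
  rw [Metric.continuousAt_iff']
  intro ε hε
  -- The path from `g p` to `g p'`: a geometric tail down to level `k`, one step between neighbours,
  -- and a geometric tail back.
  have ht : Tendsto (fun k : ℕ => K * r ^ k / (1 - r) + K * r ^ k + K * r ^ k / (1 - r)) atTop
      (𝓝 (K * 0 / (1 - r) + K * 0 + K * 0 / (1 - r))) := by
    have := tendsto_pow_atTop_nhds_zero_of_lt_one hr0 hr1
    exact ((((this.const_mul K).div_const _).add (this.const_mul K))).add
      ((this.const_mul K).div_const _)
  simp only [mul_zero, zero_div, add_zero] at ht
  obtain ⟨k, hk⟩ := (ht.eventually (gt_mem_nhds hε)).exists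
  filter_upwards [Metric.ball_mem_nhds p (by positivity : (0 : ℝ) < (1 / 2) ^ k)] with p' hp'
  have hd : ∀ i, |p i - p' i| ≤ (1 / 2) ^ k := fun i => by
    have := dist_le_pi_dist p' p i
    rw [abs_sub_comm]
    exact this.trans (le_of_lt hp')
  have hb : ∀ i, |p i| ≤ ((⌈‖p‖⌉₊ + 1 : ℕ) : ℝ) := fun i => by
    have := bd p i; push_cast; linarith
  have hb' : ∀ i, |p' i| ≤ ((⌈‖p‖⌉₊ + 1 : ℕ) : ℝ) := fun i => by
    have h1 := bd p i
    have h2 := hd i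
    have h3 : (1 / 2 : ℝ) ^ k ≤ 1 := pow_le_one₀ (by norm_num) (by norm_num)
    have h4 : |p' i| ≤ |p i| + |p i - p' i| := by
      have := abs_sub_abs_le_abs_sub (p' i) (p i)
      rw [abs_sub_comm (p' i)] at this
      linarith
    push_cast; linarith
  have e1 := dist_le_of_le_geometric_of_tendsto r K hr1 (h p hb) (hg p) k
  have e2 := dist_le_of_le_geometric_of_tendsto r K hr1 (h p' hb') (hg p') k
  have e3 := h' p p' hb k hd
  rw [Real.dist_eq, abs_le] at e1 e2 e3
  rw [Real.dist_eq, abs_lt]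
  constructor <;> linarith [e1.1, e1.2, e2.1, e2.2, e3.1, e3.2]

variable {Ω : Type*} [MeasurableSpace Ω]

/-- The integer coordinates of the dyadic points of level `k` in the box `[-R, R]^ι`. -/
noncomputable def dyadicBox (ι : Type*) [Fintype ι] [DecidableEq ι] (R k : ℕ) : Finset (ι → ℤ) :=
  Fintype.piFinset fun _ => Finset.Icc (-((R : ℤ) * 2 ^ k)) ((R : ℤ) * 2 ^ k)

/-- The steps leading from a dyadic point to its neighbours. -/
noncomputable def unitBox (ι : Type*) [Fintype ι] [DecidableEq ι] : Finset (ι → ℤ) :=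
  Fintype.piFinset fun _ => Finset.Icc (-1) 1

lemma mem_dyadicBox [DecidableEq ι] {R k : ℕ} {z : ι → ℤ} :
    z ∈ dyadicBox ι R k ↔ ∀ i, |z i| ≤ (R : ℤ) * 2 ^ k := by
  simp [dyadicBox, abs_le]

lemma mem_unitBox [DecidableEq ι] {e : ι → ℤ} : e ∈ unitBox ι ↔ ∀ i, |e i| ≤ 1 := by
  simp [unitBox, abs_le]

lemma card_dyadicBox_le [DecidableEq ι] (R k : ℕ) :
    (dyadicBox ι R k).card ≤ ((2 * R + 1) * 2 ^ k) ^ Fintype.card ι := by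
  rw [dyadicBox, Fintype.card_piFinset, Finset.prod_const, Finset.card_univ]
  refine Nat.pow_le_pow_left ?_ _
  rw [Int.card_Icc]
  have h1 : (1 : ℤ) ≤ 2 ^ k := one_le_pow₀ (by norm_num)
  have h2 : (0 : ℤ) ≤ R * 2 ^ k := by positivity
  zify
  rw [Int.toNat_of_nonneg (by linarith)]
  linarith

omit [Fintype ι] in
lemma measurable_enorm_sub_pow {X : (ι → ℝ) → Ω → ℝ} (hX : ∀ p, Measurable (X p))
    (p p' : ι → ℝ) (m : ℕ) : Measurable fun ω => ‖X p ω - X p' ω‖ₑ ^ m :=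
  ((hX p).sub (hX p')).enorm.pow_const m

/-- The sum of the `m`-th powers of the increments of `X` between neighbouring dyadic points of
level `k` in the box `[-R, R]^ι`. -/
noncomputable def dyadicOscillation [DecidableEq ι] (X : (ι → ℝ) → Ω → ℝ) (m R k : ℕ) (ω : Ω) :
    ℝ≥0∞ :=
  ∑ z ∈ dyadicBox ι R k, ∑ e ∈ unitBox ι,
    ‖X (dyadicPoint k z) ω - X (dyadicPoint k (z + e)) ω‖ₑ ^ m

lemma measurable_dyadicOscillation [DecidableEq ι] {X : (ι → ℝ) → Ω → ℝ}
    (hX : ∀ p, Measurable (X p)) (m R k : ℕ) : Measurable (dyadicOscillation X m R k) := by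
  unfold dyadicOscillation
  exact Finset.measurable_fun_sum _ fun z _ => Finset.measurable_fun_sum _ fun e _ =>
    measurable_enorm_sub_pow hX _ _ m

/-- The box holds of order `2^(k * card ι)` points and each increment contributes `2^(-k * (card ι +
1))`. The one surplus power in the moment condition leaves the factor `(1/2)^k`. -/
lemma lintegral_dyadicOscillation_le [DecidableEq ι] {P : Measure Ω} {X : (ι → ℝ) → Ω → ℝ}
    (hX : ∀ p, Measurable (X p)) {m : ℕ} {C : ℝ≥0∞}
    (h : ∀ p p', dist p p' ≤ 1 →
      ∫⁻ ω, ‖X p ω - X p' ω‖ₑ ^ m ∂P ≤ C * ENNReal.ofReal (dist p p' ^ (Fintype.card ι + 1)))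
    (R k : ℕ) :
    ∫⁻ ω, dyadicOscillation X m R k ω ∂P ≤
      C * ENNReal.ofReal ((unitBox ι).card * (2 * R + 1) ^ Fintype.card ι * (1 / 2) ^ k) := by
  unfold dyadicOscillation
  rw [lintegral_finsetSum _ fun z _ => Finset.measurable_fun_sum _ fun e _ =>
    measurable_enorm_sub_pow hX _ _ m]
  have : ∀ z ∈ dyadicBox ι R k, ∫⁻ ω, ∑ e ∈ unitBox ι,
      ‖X (dyadicPoint k z) ω - X (dyadicPoint k (z + e)) ω‖ₑ ^ m ∂P ≤
      (unitBox ι).card * (C * ENNReal.ofReal (((1 / 2) ^ k) ^ (Fintype.card ι + 1))) := by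
    intro z _
    rw [lintegral_finsetSum _ fun e _ => measurable_enorm_sub_pow hX _ _ m, ← nsmul_eq_mul]
    refine Finset.sum_le_card_nsmul _ _ _ fun e he => ?_
    have hd := dist_dyadicPoint_add_le k z e (mem_unitBox.1 he)
    refine (h _ _ (hd.trans (pow_le_one₀ (by norm_num) (by norm_num)))).trans ?_
    gcongr
  refine (Finset.sum_le_card_nsmul _ _ _ this).trans ?_
  rw [nsmul_eq_mul]
  have hc : ((dyadicBox ι R k).card : ℝ≥0∞) ≤
      ENNReal.ofReal (((2 * R + 1) * 2 ^ k) ^ Fintype.card ι) := by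
    rw [← ENNReal.ofReal_natCast]
    refine ENNReal.ofReal_le_ofReal ?_
    exact_mod_cast card_dyadicBox_le (ι := ι) R k
  calc ((dyadicBox ι R k).card : ℝ≥0∞) *
        ((unitBox ι).card * (C * ENNReal.ofReal (((1 / 2) ^ k) ^ (Fintype.card ι + 1))))
      ≤ ENNReal.ofReal (((2 * R + 1) * 2 ^ k) ^ Fintype.card ι) *
        (ENNReal.ofReal (unitBox ι).card *
          (C * ENNReal.ofReal (((1 / 2) ^ k) ^ (Fintype.card ι + 1)))) := by
        rw [ENNReal.ofReal_natCast]; gcongr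
    _ = C * ENNReal.ofReal (((2 * R + 1) * 2 ^ k) ^ Fintype.card ι * ((unitBox ι).card *
          ((1 / 2) ^ k) ^ (Fintype.card ι + 1))) := by
        rw [ENNReal.ofReal_mul (by positivity), ENNReal.ofReal_mul (by positivity)]
        ring
    _ = _ := by
        congr 2
        have : (2 : ℝ) ^ k * (1 / 2) ^ k = 1 := by rw [← mul_pow]; norm_num
        calc _ = (unitBox ι).card * (2 * R + 1) ^ Fintype.card ι * (1 / 2) ^ k *
            ((2 : ℝ) ^ k * (1 / 2) ^ k) ^ Fintype.card ι := by
              rw [mul_pow, mul_pow, pow_succ]; ring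
          _ = _ := by rw [this]; ring

omit [MeasurableSpace Ω] in
/-- A bound in terms of the weighted oscillations on the increments. -/
lemma exists_abs_sub_le_of_tsum_ne_top [DecidableEq ι] {X : (ι → ℝ) → Ω → ℝ} {m R : ℕ}
    (hm : m ≠ 0) {ω : Ω}
    (h : ∑' k, ENNReal.ofReal ((3 / 2) ^ k) * dyadicOscillation X m R k ω ≠ ⊤) :
    ∃ K r : ℝ, 0 ≤ r ∧ r < 1 ∧ ∀ (k : ℕ) (z : ι → ℤ),
      (∀ i, |z i| ≤ (R : ℤ) * 2 ^ k) → ∀ e : ι → ℤ, (∀ i, |e i| ≤ 1) →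
        |X (dyadicPoint k z) ω - X (dyadicPoint k (z + e)) ω| ≤ K * r ^ k := by
  set A := (∑' k, ENNReal.ofReal ((3 / 2) ^ k) * dyadicOscillation X m R k ω).toReal with hA
  have hm' : (0 : ℝ) < m := by positivity
  refine ⟨A ^ (1 / (m : ℝ)), (2 / 3 : ℝ) ^ (1 / (m : ℝ)), by positivity,
    Real.rpow_lt_one (by norm_num) (by norm_num) (by positivity), fun k z hz e he => ?_⟩
  set a := |X (dyadicPoint k z) ω - X (dyadicPoint k (z + e)) ω| with ha
  have h1 : ENNReal.ofReal ((3 / 2) ^ k * a ^ m) ≤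
      ∑' k, ENNReal.ofReal ((3 / 2) ^ k) * dyadicOscillation X m R k ω := by
    refine le_trans ?_ (ENNReal.le_tsum k)
    rw [ENNReal.ofReal_mul (by positivity), ENNReal.ofReal_pow (abs_nonneg _)]
    gcongr
    rw [dyadicOscillation, ← Real.enorm_eq_ofReal_abs]
    refine le_trans ?_ (Finset.single_le_sum (fun _ _ => zero_le)
      (mem_dyadicBox.2 hz))
    exact Finset.single_le_sum
      (f := fun e => ‖X (dyadicPoint k z) ω - X (dyadicPoint k (z + e)) ω‖ₑ ^ m)
      (fun _ _ => zero_le) (mem_unitBox.2 he)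
  have h2 : (3 / 2) ^ k * a ^ m ≤ A := (ENNReal.ofReal_le_iff_le_toReal h).1 h1
  have h3 : a ^ m ≤ A * (2 / 3) ^ k := by
    have e : (3 / 2 : ℝ) ^ k * (2 / 3) ^ k = 1 := by rw [← mul_pow]; norm_num
    calc a ^ m = (3 / 2) ^ k * a ^ m * (2 / 3) ^ k := by linear_combination (-a ^ m) * e
      _ ≤ _ := by gcongr
  have hA0 : 0 ≤ A := ENNReal.toReal_nonneg
  have h4 : a = (a ^ m) ^ (1 / (m : ℝ)) := by
    rw [one_div, Real.pow_rpow_inv_natCast (abs_nonneg _) hm]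
  rw [h4]
  calc (a ^ m) ^ (1 / (m : ℝ)) ≤ (A * (2 / 3) ^ k) ^ (1 / (m : ℝ)) :=
        Real.rpow_le_rpow (by positivity) h3 (by positivity)
    _ = _ := by
        rw [Real.mul_rpow hA0 (by positivity), ← Real.rpow_natCast, ← Real.rpow_natCast,
          ← Real.rpow_mul (by norm_num), ← Real.rpow_mul (by norm_num), mul_comm (k : ℝ)]

/-- Along dyadic approximations of `p`, the process converges almost surely to `X p`. -/
lemma ae_tendsto_dyadic {P : Measure Ω} {X : (ι → ℝ) → Ω → ℝ}
    (hX : ∀ p, Measurable (X p)) {m : ℕ} (hm : m ≠ 0) {C : ℝ≥0∞} (hC : C ≠ ⊤)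
    (h : ∀ p p', dist p p' ≤ 1 →
      ∫⁻ ω, ‖X p ω - X p' ω‖ₑ ^ m ∂P ≤ C * ENNReal.ofReal (dist p p' ^ (Fintype.card ι + 1)))
    (p : ι → ℝ) :
    ∀ᵐ ω ∂P, Tendsto (fun k => X (dyadicPoint k (dyadicFloor k p)) ω) atTop (𝓝 (X p ω)) := by
  -- The expected `m`-th powers of the errors are summable, so almost surely their series converges
  -- and the errors tend to zero.
  have hfin : ∫⁻ ω, ∑' k, ‖X (dyadicPoint k (dyadicFloor k p)) ω - X p ω‖ₑ ^ m ∂P ≠ ⊤ := by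
    rw [lintegral_tsum fun k => (measurable_enorm_sub_pow hX _ _ m).aemeasurable]
    have hle : ∀ k, ∫⁻ ω, ‖X (dyadicPoint k (dyadicFloor k p)) ω - X p ω‖ₑ ^ m ∂P ≤
        C * ENNReal.ofReal ((1 / 2) ^ k) := by
      intro k
      have hd := dist_dyadicPoint_dyadicFloor_le k p
      have h1 : (1 / 2 : ℝ) ^ k ≤ 1 := pow_le_one₀ (by norm_num) (by norm_num)
      refine (h _ _ (hd.trans h1)).trans ?_
      gcongr
      rw [pow_succ]
      exact (mul_le_of_le_one_left dist_nonneg (pow_le_one₀ dist_nonneg (hd.trans h1))).trans hd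
    refine ne_top_of_le_ne_top ?_ (ENNReal.tsum_le_tsum hle)
    rw [ENNReal.tsum_mul_left]
    refine ENNReal.mul_ne_top hC ?_
    rw [← ENNReal.ofReal_tsum_of_nonneg (fun _ => by positivity)
      (summable_geometric_of_lt_one (by norm_num) (by norm_num))]
    exact ENNReal.ofReal_ne_top
  filter_upwards [ae_lt_top (.tsum fun k => measurable_enorm_sub_pow hX _ _ m) hfin] with ω hω
  have h0 := ENNReal.tendsto_atTop_zero_of_tsum_ne_top hω.ne
  rw [tendsto_iff_edist_tendsto_0]
  have h1 := h0.ennrpow_const (1 / (m : ℝ))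
  have hm' : (0 : ℝ) < m := by positivity
  rw [ENNReal.zero_rpow_of_pos (by positivity)] at h1
  refine h1.congr fun k => ?_
  rw [one_div, ENNReal.pow_rpow_inv_natCast hm, edist_eq_enorm_sub]

/-- **Kolmogorov–Chentsov theorem**: a process indexed by `ℝ^ι` the increments of which satisfy the
Kolmogorov condition has a modification with continuous sample paths. -/
theorem exists_continuous_modification {P : Measure Ω} {X : (ι → ℝ) → Ω → ℝ}
    (hX : ∀ p, Measurable (X p)) {m : ℕ} (hm : m ≠ 0) {C : ℝ≥0∞} (hC : C ≠ ⊤)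
    (h : ∀ p p', dist p p' ≤ 1 →
      ∫⁻ ω, ‖X p ω - X p' ω‖ₑ ^ m ∂P ≤ C * ENNReal.ofReal (dist p p' ^ (Fintype.card ι + 1))) :
    ∃ Y : (ι → ℝ) → Ω → ℝ, (∀ p, Measurable (Y p)) ∧ (∀ p, ∀ᵐ ω ∂P, Y p ω = X p ω) ∧
      ∀ ω, Continuous fun p => Y p ω := by
  classical
  -- The weight `(3/2)^k` grows, so finiteness of the sum makes the oscillations decay like
  -- `(2/3)^k`; its ratio is below `2`, so the expectations, of order `(3/4)^k`, remain summable.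
  set S : ℕ → Ω → ℝ≥0∞ :=
    fun R ω => ∑' k, ENNReal.ofReal ((3 / 2) ^ k) * dyadicOscillation X m R k ω with hS
  have hSm : ∀ R, Measurable (S R) := fun R =>
    .tsum fun k => (measurable_dyadicOscillation hX m R k).const_mul _
  have hSfin : ∀ R, ∫⁻ ω, S R ω ∂P ≠ ⊤ := by
    intro R
    rw [hS, lintegral_tsum fun k =>
      ((measurable_dyadicOscillation hX m R k).const_mul _).aemeasurable]
    set B : ℝ := (unitBox ι).card * (2 * R + 1) ^ Fintype.card ι with hB
    have hle : ∀ k, ∫⁻ ω, ENNReal.ofReal ((3 / 2) ^ k) * dyadicOscillation X m R k ω ∂P ≤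
        C * ENNReal.ofReal (B * (3 / 4) ^ k) := by
      intro k
      rw [lintegral_const_mul _ (measurable_dyadicOscillation hX m R k)]
      calc _ ≤ ENNReal.ofReal ((3 / 2) ^ k) * (C * ENNReal.ofReal (B * (1 / 2) ^ k)) := by
            gcongr; exact lintegral_dyadicOscillation_le hX h R k
        _ = C * ENNReal.ofReal ((3 / 2) ^ k * (B * (1 / 2) ^ k)) := by
            rw [ENNReal.ofReal_mul (by positivity : (0 : ℝ) ≤ (3 / 2) ^ k)]; ring
        _ = _ := by
            congr 2
            rw [mul_left_comm, ← mul_pow]; norm_num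
    refine ne_top_of_le_ne_top ?_ (ENNReal.tsum_le_tsum hle)
    rw [ENNReal.tsum_mul_left]
    refine ENNReal.mul_ne_top hC ?_
    rw [← ENNReal.ofReal_tsum_of_nonneg (fun _ => by positivity)
      ((summable_geometric_of_lt_one (by norm_num) (by norm_num)).mul_left _)]
    exact ENNReal.ofReal_ne_top
  set G : Set Ω := {ω | ∀ R, S R ω < ⊤} with hG
  have hGm : MeasurableSet G := by
    rw [hG, Set.ofPred_forall]
    exact .iInter fun R => measurableSet_lt (hSm R) measurable_const
  have hGae : ∀ᵐ ω ∂P, ω ∈ G := ae_all_iff.2 fun R => ae_lt_top (hSm R) (hSfin R)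
  -- Off the good event the approximations are replaced by zero, so the limit exists and is
  -- continuous for every `ω` and is measurable as a pointwise limit.
  have hlim : ∀ ω, ∃ g : (ι → ℝ) → ℝ, Continuous g ∧ ∀ p, Tendsto
      (fun k => G.indicator (X (dyadicPoint k (dyadicFloor k p))) ω) atTop (𝓝 (g p)) := by
    intro ω
    by_cases hω : ω ∈ G
    · simp only [Set.indicator_of_mem hω]
      exact exists_continuous_tendsto_dyadic (f := fun p => X p ω) fun R =>
        exists_abs_sub_le_of_tsum_ne_top hm (hω R).ne
    · simp only [Set.indicator_of_notMem hω]
      exact ⟨0, continuous_const, fun p => tendsto_const_nhds⟩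
  choose g hgc hg using hlim
  refine ⟨fun p ω => g ω p, fun p => ?_, fun p => ?_, hgc⟩
  · exact measurable_of_tendsto_metrizable (fun k => (hX _).indicator hGm)
      (tendsto_pi_nhds.2 fun ω => hg ω p)
  · filter_upwards [hGae, ae_tendsto_dyadic hX hm hC h p] with ω hω hω'
    refine tendsto_nhds_unique ?_ hω'
    have := hg ω p
    simpa only [Set.indicator_of_mem hω] using this

end Kolmogorov

/-! ### The heat kernel, the initial term and the drift -/

section HeatKernel

variable {d : ℕ}

lemma heatKernel_nonneg {t : ℝ} (ht : 0 ≤ t) (x : Space d) : 0 ≤ heatKernel t x := by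
  unfold heatKernel
  have := Real.pi_pos
  positivity

lemma measurable_heatKernel : Measurable fun p : ℝ × Space d => heatKernel p.1 p.2 := by
  unfold heatKernel
  fun_prop

lemma continuousAt_heatKernel {p : ℝ × Space d} (hp : 0 < p.1) :
    ContinuousAt (fun p : ℝ × Space d => heatKernel p.1 p.2) p := by
  unfold heatKernel
  have h0 : (2 * Real.pi * p.1) ^ ((d : ℝ) / 2) ≠ 0 := by
    have := Real.pi_pos
    positivity
  have h1 : 2 * Real.pi * p.1 ≠ 0 := by
    have := Real.pi_pos
    positivity
  have h2 : 2 * p.1 ≠ 0 := by positivity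
  have e1 : ContinuousAt (fun p : ℝ × Space d => (2 * Real.pi * p.1) ^ ((d : ℝ) / 2)) p :=
    ContinuousAt.rpow_const (by fun_prop) (Or.inl h1)
  have e2 : ContinuousAt (fun p : ℝ × Space d => -(‖p.2‖ ^ 2 / (2 * p.1))) p := by
    fun_prop (disch := exact h2)
  exact (continuousAt_const.div e1 h0).mul e2.rexp

/-- The Fourier transform of a translated heat kernel. -/
lemma fourier_heatKernel_sub {t : ℝ} (ht : 0 < t) (x ξ : Space d) :
    fourier (fun y => heatKernel t (x - y)) ξ =
      Complex.exp (-(Complex.I * ((inner ℝ ξ x : ℝ) : ℂ))) *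
        ((Real.exp (-(t * ‖ξ‖ ^ 2 / 2)) : ℝ) : ℂ) := by
  have hpi := Real.pi_pos
  unfold fourier
  rw [← integral_sub_left_eq_self _ _ x]
  have hb : 0 < ((1 / (2 * t) : ℝ) : ℂ).re := by
    rw [Complex.ofReal_re]; positivity
  have key := GaussianFourier.integral_cexp_neg_mul_sq_norm_add hb Complex.I ξ
  have hc : ((2 * Real.pi * t) ^ ((d : ℝ) / 2) : ℝ) ≠ 0 := by positivity
  have hcc : ((Real.pi : ℂ) / ((1 / (2 * t) : ℝ) : ℂ)) ^ ((Module.finrank ℝ (Space d) : ℂ) / 2) =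
      (((2 * Real.pi * t) ^ ((d : ℝ) / 2) : ℝ) : ℂ) := by
    rw [Complex.ofReal_cpow (by positivity), finrank_euclideanSpace_fin]
    congr 1
    · push_cast; field_simp
    · push_cast; rfl
  rw [hcc] at key
  calc ∫ y, Complex.exp (-(Complex.I * ((inner ℝ ξ (x - y) : ℝ) : ℂ))) *
        ((heatKernel t (x - (x - y)) : ℝ) : ℂ)
      = ∫ y, Complex.exp (-(Complex.I * ((inner ℝ ξ x : ℝ) : ℂ))) *
        (((2 * Real.pi * t) ^ ((d : ℝ) / 2) : ℝ) : ℂ)⁻¹ *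
        Complex.exp (-((1 / (2 * t) : ℝ) : ℂ) * ‖y‖ ^ 2 +
          Complex.I * ((inner ℝ ξ y : ℝ) : ℂ)) := by
        congr 1 with y
        rw [heatKernel, sub_sub_cancel, inner_sub_right, Complex.exp_add]
        push_cast
        rw [mul_sub, neg_sub, sub_eq_add_neg, add_comm, Complex.exp_add]
        have : -((‖y‖ : ℂ) ^ 2 / (2 * t)) = -(1 / (2 * (t : ℂ))) * ‖y‖ ^ 2 := by ring
        rw [this, one_div]
        ring
    _ = _ := by
        rw [integral_const_mul, key, mul_assoc, inv_mul_cancel_left₀ (by exact_mod_cast hc)]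
        congr 1
        push_cast
        congr 1
        rw [Complex.I_sq]
        have : (t : ℂ) ≠ 0 := by exact_mod_cast ht.ne'
        field_simp
        norm_num

/-- The value of the Fourier transform at frequency zero. -/
lemma integral_heatKernel_sub {t : ℝ} (ht : 0 < t) (x : Space d) :
    ∫ y, heatKernel t (x - y) = 1 := by
  have h := fourier_heatKernel_sub ht x 0
  unfold fourier at h
  simp only [inner_zero_left, Complex.ofReal_zero, mul_zero, neg_zero, Complex.exp_zero, one_mul,
    norm_zero, ne_eq, OfNat.ofNat_ne_zero, not_false_eq_true, zero_pow, zero_div,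
    Real.exp_zero, Complex.ofReal_one] at h
  rw [integral_complex_ofReal] at h
  exact_mod_cast h

/-- The Bochner integral of a non-integrable function is zero by convention, so an integral equal to
one forces integrability. -/
lemma integrable_heatKernel_sub {t : ℝ} (ht : 0 < t) (x : Space d) :
    Integrable fun y => heatKernel t (x - y) := by
  by_contra h
  have := integral_heatKernel_sub ht x
  rw [integral_undef h] at this
  norm_num at this

lemma integrable_heatKernel {t : ℝ} (ht : 0 < t) :
    Integrable (heatKernel t : Space d → ℝ) := by
  simpa using (integrable_heatKernel_sub (d := d) ht 0).comp_sub_left 0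

lemma integral_heatKernel {t : ℝ} (ht : 0 < t) : ∫ y : Space d, heatKernel t y = 1 := by
  rw [← integral_heatKernel_sub ht (0 : Space d), integral_sub_left_eq_self]

lemma abs_integral_mul_heatKernel_le {f : Space d → ℝ} {M : ℝ} (hM : ∀ y, |f y| ≤ M)
    {t : ℝ} (ht : 0 < t) (x : Space d) :
    |∫ y, f y * heatKernel t (x - y)| ≤ M := by
  calc |∫ y, f y * heatKernel t (x - y)| ≤ ∫ y, M * heatKernel t (x - y) := by
        rw [← Real.norm_eq_abs]
        refine norm_integral_le_of_norm_le ((integrable_heatKernel_sub ht x).const_mul M)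
          (.of_forall fun y => ?_)
        rw [norm_mul, Real.norm_eq_abs, Real.norm_of_nonneg (heatKernel_nonneg ht.le _)]
        exact mul_le_mul_of_nonneg_right (hM y) (heatKernel_nonneg ht.le _)
    _ = M := by rw [integral_const_mul, integral_heatKernel_sub ht, mul_one]

/-- A Gaussian bound for the heat kernel, locally uniform in its parameters. -/
lemma exists_heatKernel_le {t₀ : ℝ} (ht₀ : 0 < t₀) (x₀ : Space d) :
    ∃ K, ∀ᶠ p : ℝ × Space d in 𝓝 (t₀, x₀), ∀ y,
      heatKernel p.1 (p.2 - y) ≤ K * heatKernel (4 * t₀) (x₀ - y) := by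
  have hpi := Real.pi_pos
  -- The neighbourhood is `t₀/2 < t < 2t₀`, `‖x - x₀‖ < 1`. The three factors are the prefactor at
  -- its largest time bound, the cost of shifting the centre, and the inverse of the normalisation
  -- at time `4t₀`. That time is twice `2t₀` because `‖x₀ - y‖² ≤ 2‖x - y‖² + 2`.
  refine ⟨1 / (2 * Real.pi * (t₀ / 2)) ^ ((d : ℝ) / 2) * Real.exp (1 / (4 * t₀)) *
    (2 * Real.pi * (4 * t₀)) ^ ((d : ℝ) / 2), ?_⟩
  have h1 : ∀ᶠ p : ℝ × Space d in 𝓝 (t₀, x₀), t₀ / 2 < p.1 ∧ p.1 < 2 * t₀ ∧ ‖p.2 - x₀‖ < 1 := by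
    have hc : Continuous fun p : ℝ × Space d => ‖p.2 - x₀‖ := by fun_prop
    refine (continuous_fst.continuousAt.eventually_const_lt (by simp; linarith)).and
      ((continuous_fst.continuousAt.eventually_lt_const (by simp; linarith)).and
      (hc.continuousAt.eventually_lt_const (by simp)))
  filter_upwards [h1] with p hp y
  obtain ⟨hp1, hp2, hp3⟩ := hp
  have hp0 : 0 < p.1 := by linarith
  have hn : ‖x₀ - y‖ ^ 2 ≤ 2 * ‖p.2 - y‖ ^ 2 + 2 := by
    have h3 : ‖x₀ - y‖ ≤ ‖p.2 - y‖ + ‖p.2 - x₀‖ := by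
      have : x₀ - y = (p.2 - y) - (p.2 - x₀) := by abel
      rw [this]; exact norm_sub_le _ _
    have h4 := norm_nonneg (x₀ - y)
    have h5 := norm_nonneg (p.2 - y)
    have h6 := norm_nonneg (p.2 - x₀)
    nlinarith [sq_nonneg (‖p.2 - y‖ - ‖p.2 - x₀‖)]
  have e1 : Real.exp (-(‖p.2 - y‖ ^ 2 / (2 * p.1))) ≤
      Real.exp (1 / (4 * t₀)) * Real.exp (-(‖x₀ - y‖ ^ 2 / (2 * (4 * t₀)))) := by
    rw [← Real.exp_add]
    refine Real.exp_le_exp.2 ?_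
    have h7 : ‖p.2 - y‖ ^ 2 / (4 * t₀) ≤ ‖p.2 - y‖ ^ 2 / (2 * p.1) := by
      exact div_le_div_of_nonneg_left (by positivity) (by positivity) (by linarith)
    have h8 : ‖x₀ - y‖ ^ 2 / (2 * (4 * t₀)) - 1 / (4 * t₀) ≤ ‖p.2 - y‖ ^ 2 / (4 * t₀) := by
      have : ‖x₀ - y‖ ^ 2 / (2 * (4 * t₀)) - 1 / (4 * t₀) =
        ((‖x₀ - y‖ ^ 2 - 2) / 2) / (4 * t₀) := by field_simp
      rw [this]
      gcongr
      linarith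
    linarith
  have e2 : 1 / (2 * Real.pi * p.1) ^ ((d : ℝ) / 2) ≤
      1 / (2 * Real.pi * (t₀ / 2)) ^ ((d : ℝ) / 2) := by
    gcongr
  unfold heatKernel
  calc _ ≤ 1 / (2 * Real.pi * (t₀ / 2)) ^ ((d : ℝ) / 2) *
        (Real.exp (1 / (4 * t₀)) * Real.exp (-(‖x₀ - y‖ ^ 2 / (2 * (4 * t₀))))) := by
        gcongr
    _ = _ := by
        have : ((2 * Real.pi * (4 * t₀)) ^ ((d : ℝ) / 2) : ℝ) ≠ 0 := by positivity
        field_simp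

lemma continuousAt_integral_mul_heatKernel {f : Space d → ℝ} (hf : Measurable f) {M : ℝ}
    (hM : ∀ y, |f y| ≤ M) {p : ℝ × Space d} (hp : 0 < p.1) :
    ContinuousAt (fun p : ℝ × Space d => ∫ y, f y * heatKernel p.1 (p.2 - y)) p := by
  obtain ⟨t₀, x₀⟩ := p
  obtain ⟨K, hK⟩ := exists_heatKernel_le hp x₀
  have hpos : ∀ᶠ p : ℝ × Space d in 𝓝 (t₀, x₀), 0 < p.1 :=
    continuous_fst.continuousAt.eventually_const_lt hp
  refine tendsto_integral_filter_of_dominated_convergence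
    (fun y => M * (K * heatKernel (4 * t₀) (x₀ - y))) (.of_forall fun p => ?_) ?_
    (((integrable_heatKernel_sub (by simp at hp; linarith) x₀).const_mul K).const_mul M)
    (.of_forall fun y => ?_)
  · exact (hf.mul (measurable_heatKernel.comp
      (measurable_const.prodMk (measurable_const.sub measurable_id)))).aestronglyMeasurable
  · filter_upwards [hK, hpos] with p hp hp0
    refine .of_forall fun y => ?_
    rw [norm_mul, Real.norm_eq_abs, Real.norm_of_nonneg (heatKernel_nonneg hp0.le _)]
    exact mul_le_mul (hM y) (hp y) (heatKernel_nonneg hp0.le _) ((abs_nonneg _).trans (hM y))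
  · refine tendsto_const_nhds.mul ?_
    have hc : ContinuousAt (fun p : ℝ × Space d => (p.1, p.2 - y)) (t₀, x₀) := by fun_prop
    exact ContinuousAt.comp (g := fun p : ℝ × Space d => heatKernel p.1 p.2) (x := (t₀, x₀))
      (continuousAt_heatKernel hp) hc

/-- Brownian scaling of the heat kernel. -/
lemma integral_mul_heatKernel_eq (f : Space d → ℝ) {t : ℝ} (ht : 0 < t) (x : Space d) :
    ∫ y, f y * heatKernel t (x - y) = ∫ z, f (x - √t • z) * heatKernel 1 z := by
  have hpi := Real.pi_pos
  have hs : 0 < √t := Real.sqrt_pos.2 ht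
  have h1 : ∫ y, f y * heatKernel t (x - y) = ∫ y, f (x - y) * heatKernel t y := by
    rw [← integral_sub_left_eq_self (fun y => f y * heatKernel t (x - y)) _ x]
    simp
  have h2 := Measure.integral_comp_smul (volume : Measure (Space d))
    (fun y => f (x - y) * heatKernel t y) √t
  rw [finrank_euclideanSpace_fin, abs_of_pos (by positivity), smul_eq_mul] at h2
  rw [h1, ← mul_right_inj' (by positivity : ((√t ^ d)⁻¹ : ℝ) ≠ 0), ← h2, ← integral_const_mul]
  congr 1 with z
  have h3 : ‖√t • z‖ ^ 2 / (2 * t) = ‖z‖ ^ 2 / (2 * 1) := by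
    rw [norm_smul, Real.norm_of_nonneg hs.le, mul_pow, Real.sq_sqrt ht.le]
    field_simp
  have h4 : (2 * Real.pi * t) ^ ((d : ℝ) / 2) = (2 * Real.pi * 1) ^ ((d : ℝ) / 2) * √t ^ d := by
    rw [mul_one, Real.mul_rpow (by positivity) ht.le, Real.sqrt_eq_rpow, ← Real.rpow_natCast,
      ← Real.rpow_mul ht.le]
    congr 2
    ring
  rw [heatKernel, heatKernel, h3, h4]
  have : ((2 * Real.pi * 1) ^ ((d : ℝ) / 2) : ℝ) ≠ 0 := by positivity
  field_simp

lemma continuousOn_heatInit {u₀ : Space d → ℝ} (hm : Measurable u₀) {M : ℝ}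
    (hM : ∀ x, |u₀ x| ≤ M) :
    ContinuousOn (fun p : ℝ × Space d => heatInit u₀ p.1 p.2) (Set.Ioi 0 ×ˢ Set.univ) := by
  intro p hp
  have hp' : 0 < p.1 := hp.1
  refine ((continuousAt_integral_mul_heatKernel hm hM hp').congr ?_).continuousWithinAt
  filter_upwards [continuous_fst.continuousAt.eventually_const_lt hp'] with p' h
  rw [heatInit, if_neg h.ne']

/-- Scaling moves the singularity at `t = 0` out of the kernel and into the argument of `u₀`. At `t
= 0` the shift vanishes and the mass one of the Gaussian returns `u₀ x`, so both cases of the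
definition share one formula. -/
lemma heatInit_eq_integral (u₀ : Space d → ℝ) {t : ℝ} (ht : 0 ≤ t) (x : Space d) :
    heatInit u₀ t x = ∫ z, u₀ (x - √t • z) * heatKernel 1 z := by
  rcases ht.eq_or_lt with rfl | ht
  · simp [heatInit, integral_const_mul, integral_heatKernel]
  · rw [heatInit, if_neg ht.ne', integral_mul_heatKernel_eq _ ht]

/-- In the scaled formula the argument of `u₀` tends to `x` for each fixed `z`, so continuity at
this single point suffices for dominated convergence. -/
lemma continuousWithinAt_heatInit {u₀ : Space d → ℝ} (hm : Measurable u₀) {M : ℝ}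
    (hM : ∀ x, |u₀ x| ≤ M) {x : Space d} (hx : ContinuousAt u₀ x) :
    ContinuousWithinAt (fun p : ℝ × Space d => heatInit u₀ p.1 p.2) (Set.Ici 0 ×ˢ Set.univ)
      (0, x) := by
  have key : ContinuousAt (fun p : ℝ × Space d => ∫ z, u₀ (p.2 - √p.1 • z) * heatKernel 1 z)
      (0, x) := by
    refine tendsto_integral_filter_of_dominated_convergence
      (fun y => M * heatKernel 1 y) (.of_forall fun p => ?_) (.of_forall fun p => ?_)
      ((integrable_heatKernel one_pos).const_mul M) (.of_forall fun z => ?_)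
    · have h1 : Measurable fun z : Space d => p.2 - √p.1 • z := by fun_prop
      have h2 : Measurable fun z : Space d => heatKernel 1 z :=
        measurable_heatKernel.comp (measurable_const.prodMk measurable_id)
      exact ((hm.comp h1).mul h2).aestronglyMeasurable
    · refine .of_forall fun z => ?_
      rw [norm_mul, Real.norm_eq_abs, Real.norm_of_nonneg (heatKernel_nonneg one_pos.le _)]
      exact mul_le_mul_of_nonneg_right (hM _) (heatKernel_nonneg one_pos.le _)
    · refine Tendsto.mul_const _ ?_
      have hc : ContinuousAt (fun p : ℝ × Space d => p.2 - √p.1 • z) (0, x) := by fun_prop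
      have h0 : x - √(0 : ℝ) • z = x := by simp
      exact ContinuousAt.comp (g := u₀) (f := fun p : ℝ × Space d => p.2 - √p.1 • z)
        (x := (0, x)) (by simpa [h0] using hx) hc
  refine key.continuousWithinAt.congr (fun p hp => heatInit_eq_integral u₀ hp.1 _)
    (heatInit_eq_integral u₀ le_rfl _)

/-- The drift term `∫_0^t (f(s) * G_{t-s})(x) ds` is measurable in an additional parameter. -/
lemma measurable_drift {Ω : Type*} [MeasurableSpace Ω] {F : ℝ → Space d → Ω → ℝ}
    (hF : Measurable fun p : ℝ × Space d × Ω => F p.1 p.2.1 p.2.2) (t : ℝ) (x : Space d) :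
    Measurable fun ω => ∫ s in (0 : ℝ)..t, ∫ y, F s y ω * heatKernel (t - s) (x - y) := by
  have h1 : Measurable fun p : (Ω × ℝ) × Space d =>
      F p.1.2 p.2 p.1.1 * heatKernel (t - p.1.2) (x - p.2) := by
    refine (hF.comp (g := fun p : ℝ × Space d × Ω => F p.1 p.2.1 p.2.2)
      (f := fun p : (Ω × ℝ) × Space d => (p.1.2, p.2, p.1.1)) (by fun_prop)).mul
      (measurable_heatKernel.comp (f := fun p : (Ω × ℝ) × Space d => (t - p.1.2, x - p.2))
        (by fun_prop))
  have h2 : StronglyMeasurable fun p : Ω × ℝ =>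
      ∫ y, F p.2 y p.1 * heatKernel (t - p.2) (x - y) :=
    h1.stronglyMeasurable.integral_prod_right
  simp only [intervalIntegral]
  exact (h2.integral_prod_right.sub h2.integral_prod_right).measurable

lemma aestronglyMeasurable_integral_mul_heatKernel {f : ℝ → Space d → ℝ}
    (hf : Measurable fun p : ℝ × Space d => f p.1 p.2) (t : ℝ) (x : Space d) (ν : Measure ℝ) :
    AEStronglyMeasurable (fun s => ∫ y, f s y * heatKernel (t - s) (x - y)) ν := by
  have h1 : Measurable fun p : ℝ × Space d => f p.1 p.2 * heatKernel (t - p.1) (x - p.2) :=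
    hf.mul (measurable_heatKernel.comp (f := fun p : ℝ × Space d => (t - p.1, x - p.2))
      (by fun_prop))
  exact h1.stronglyMeasurable.integral_prod_right.aestronglyMeasurable

/-- The drift term `∫_0^t (f(s) * G_{t-s})(x) ds` of a bounded measurable function `f` is
continuous. -/
lemma continuousOn_drift {f : ℝ → Space d → ℝ}
    (hf : Measurable fun p : ℝ × Space d => f p.1 p.2) {M : ℝ} (hM : ∀ s y, |f s y| ≤ M) :
    ContinuousOn (fun p : ℝ × Space d =>
      ∫ s in (0 : ℝ)..p.1, ∫ y, f s y * heatKernel (p.1 - s) (p.2 - y))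
      (Set.Ici 0 ×ˢ Set.univ) := by
  have hM0 : 0 ≤ M := (abs_nonneg _).trans (hM 0 0)
  have heq : ∀ p ∈ Set.Ici (0 : ℝ) ×ˢ (Set.univ : Set (Space d)),
      ∫ s in (0 : ℝ)..p.1, ∫ y, f s y * heatKernel (p.1 - s) (p.2 - y) =
      ∫ s in Set.Ioi (0 : ℝ), (Set.Iio p.1).indicator
        (fun s => ∫ y, f s y * heatKernel (p.1 - s) (p.2 - y)) s := by
    intro p hp
    rw [intervalIntegral.integral_of_le hp.1, integral_Ioc_eq_integral_Ioo,
      setIntegral_indicator measurableSet_Iio, Set.Ioi_inter_Iio]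
  refine ContinuousOn.congr (fun p _ => ContinuousAt.continuousWithinAt ?_) heq
  obtain ⟨t₀, x₀⟩ := p
  have hev : ∀ᶠ p : ℝ × Space d in 𝓝 (t₀, x₀), p.1 < t₀ + 1 :=
    continuous_fst.continuousAt.eventually_lt_const (by simp)
  refine tendsto_integral_filter_of_dominated_convergence
    ((Set.Iio (t₀ + 1)).indicator fun _ => M) (.of_forall fun p => ?_) ?_ ?_ ?_
  · exact (aestronglyMeasurable_integral_mul_heatKernel hf _ _ _).indicator measurableSet_Iio
  · filter_upwards [hev] with p hp
    refine .of_forall fun s => ?_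
    by_cases hs : s < p.1
    · rw [Set.indicator_of_mem (Set.mem_Iio.2 hs),
        Set.indicator_of_mem (Set.mem_Iio.2 (hs.trans hp))]
      exact abs_integral_mul_heatKernel_le (hM s) (by linarith) _
    · rw [Set.indicator_of_notMem (by simpa using hs), norm_zero]
      exact Set.indicator_nonneg (fun _ _ => hM0) _
  · rw [integrable_indicator_iff measurableSet_Iio]
    refine integrableOn_const ?_
    rw [Measure.restrict_apply measurableSet_Iio, Set.inter_comm, Set.Ioi_inter_Iio,
      Real.volume_Ioo]
    exact ENNReal.ofReal_ne_top
  -- The integrand can fail to be continuous in the parameters only at `s = t₀`, a null set. For `s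
  -- < t₀` the indicator is locally one, for `s > t₀` locally zero.
  · have hne : ∀ᵐ s ∂(volume.restrict (Set.Ioi (0 : ℝ))), s ≠ t₀ :=
      ae_restrict_of_ae (Measure.ae_ne volume t₀)
    filter_upwards [hne] with s hs
    rcases hs.lt_or_gt with hs | hs
    · have h1 : ∀ᶠ p : ℝ × Space d in 𝓝 (t₀, x₀), s < p.1 :=
        continuous_fst.continuousAt.eventually_const_lt hs
      have hc : ContinuousAt (fun p : ℝ × Space d => (p.1 - s, p.2)) (t₀, x₀) := by fun_prop
      have h2 := ContinuousAt.comp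
        (g := fun p : ℝ × Space d => ∫ y, f s y * heatKernel p.1 (p.2 - y)) (x := (t₀, x₀))
        (continuousAt_integral_mul_heatKernel (hf.comp measurable_prodMk_left) (hM s)
          (by simpa using hs)) hc
      refine h2.congr ?_
      filter_upwards [h1] with p hp
      rw [Set.indicator_of_mem (Set.mem_Iio.2 hp)]
      rfl
    · have h1 : ∀ᶠ p : ℝ × Space d in 𝓝 (t₀, x₀), p.1 < s :=
        continuous_fst.continuousAt.eventually_lt_const hs
      refine ContinuousAt.congr (f := fun _ => (0 : ℝ)) continuousAt_const ?_
      filter_upwards [h1] with p hp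
      rw [Set.indicator_of_notMem (by simpa using hp.le)]

end HeatKernel

/-! ### Fourier decay of test functions -/

section TestFunctions

variable {d : ℕ}

lemma TestFunction.measurable (φ : TestFunction d) :
    Measurable fun p : ℝ × Space d => φ.toFun p.1 p.2 := by
  obtain ⟨ψ, hψ, -, h⟩ := φ.smooth
  have : (fun p : ℝ × Space d => φ.toFun p.1 p.2) =
      (Prod.fst ⁻¹' Set.Ici (0 : ℝ)).indicator ψ := by
    funext p
    by_cases hp : 0 ≤ p.1
    · rw [Set.indicator_of_mem (by exact hp), h _ hp]
    · rw [Set.indicator_of_notMem (by simpa using hp), φ.zero_of_neg _ (not_le.1 hp)]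
  rw [this]
  exact hψ.continuous.measurable.indicator (measurable_fst measurableSet_Ici)

/-- A test function is supported in a bounded set, bounded, and Lipschitz in space, uniformly in
time. -/
lemma TestFunction.exists_bounds (φ : TestFunction d) :
    ∃ R A L : ℝ, 0 ≤ R ∧ 0 ≤ A ∧ 0 ≤ L ∧ (∀ t x, R < |t| ∨ R < ‖x‖ → φ.toFun t x = 0) ∧
      (∀ t x, |φ.toFun t x| ≤ A) ∧ ∀ t x y, |φ.toFun t x - φ.toFun t y| ≤ L * ‖x - y‖ := by
  obtain ⟨ψ, hψ, hs, h⟩ := φ.smooth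
  obtain ⟨R, hR⟩ := hs.isCompact.isBounded.exists_norm_le
  obtain ⟨A, hA⟩ := hs.exists_bound_of_continuous hψ.continuous
  obtain ⟨L, hL⟩ := hψ.lipschitzWith_of_hasCompactSupport hs (by simp)
  have hA0 : 0 ≤ A := (norm_nonneg _).trans (hA 0)
  have hz : ∀ t x, R < |t| ∨ R < ‖x‖ → φ.toFun t x = 0 := by
    intro t x htx
    by_cases ht : 0 ≤ t
    · rw [h t ht]
      by_contra hne
      have := hR _ (subset_tsupport _ hne)
      rw [Prod.norm_mk, max_le_iff, Real.norm_eq_abs] at this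
      rcases htx with h1 | h1 <;> linarith [this.1, this.2]
    · exact φ.zero_of_neg _ (not_le.1 ht) _
  refine ⟨max R 0, A, L, le_max_right _ _, hA0, L.2, fun t x htx => hz t x ?_,
    fun t x => ?_, fun t x y => ?_⟩
  · exact htx.imp (lt_of_le_of_lt (le_max_left _ _)) (lt_of_le_of_lt (le_max_left _ _))
  · by_cases ht : 0 ≤ t
    · rw [h t ht]; exact hA _
    · rw [φ.zero_of_neg _ (not_le.1 ht), abs_zero]; exact hA0
  · by_cases ht : 0 ≤ t
    · rw [h t ht, h t ht, ← Real.dist_eq]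
      refine (hL.dist_le_mul _ _).trans_eq ?_
      rw [dist_eq_norm, Prod.mk_sub_mk, Prod.norm_mk, sub_self, norm_zero,
        max_eq_right (norm_nonneg _)]
    · rw [φ.zero_of_neg _ (not_le.1 ht), φ.zero_of_neg _ (not_le.1 ht), sub_zero, abs_zero]
      have : (0 : ℝ) ≤ L := L.2
      positivity

lemma measurable_fourier {f : ℝ → Space d → ℝ} (hf : Measurable fun p : ℝ × Space d => f p.1 p.2) :
    Measurable fun p : ℝ × Space d => fourier (f p.1) p.2 := by
  unfold fourier
  have h1 : Measurable fun p : (ℝ × Space d) × Space d => f p.1.1 p.2 :=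
    hf.comp (f := fun p : (ℝ × Space d) × Space d => (p.1.1, p.2)) (by fun_prop)
  have h2 : Measurable fun p : (ℝ × Space d) × Space d =>
      Complex.exp (-(Complex.I * ((inner ℝ p.1.2 p.2 : ℝ) : ℂ))) * ((f p.1.1 p.2 : ℝ) : ℂ) := by
    refine Measurable.mul ?_ (Complex.measurable_ofReal.comp h1)
    fun_prop
  exact (h2.stronglyMeasurable.integral_prod_right).measurable

lemma norm_exp_neg_I_mul (r : ℝ) : ‖Complex.exp (-(Complex.I * (r : ℂ)))‖ = 1 := by
  have : -(Complex.I * (r : ℂ)) = ((-r : ℝ) : ℂ) * Complex.I := by push_cast; ring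
  rw [this, Complex.norm_exp_ofReal_mul_I]

lemma norm_fourier_le {f : Space d → ℝ} {R A : ℝ} (hR : ∀ x, R < ‖x‖ → f x = 0)
    (hA : ∀ x, |f x| ≤ A) (ξ : Space d) :
    ‖fourier f ξ‖ ≤ A * volume.real (Metric.closedBall (0 : Space d) R) := by
  unfold fourier
  rw [← setIntegral_eq_integral_of_forall_compl_eq_zero (s := Metric.closedBall (0 : Space d) R)]
  · refine norm_setIntegral_le_of_norm_le_const
      (isCompact_closedBall _ _).measure_lt_top fun x _ => ?_
    rw [norm_mul, norm_exp_neg_I_mul, one_mul, Complex.norm_real]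
    exact hA x
  · intro x hx
    rw [hR x (by simpa using hx)]
    simp

lemma integrable_exp_mul {f : Space d → ℝ} (hf : Integrable f) (ξ : Space d) :
    Integrable fun x => Complex.exp (-(Complex.I * ((inner ℝ ξ x : ℝ) : ℂ))) * ((f x : ℝ) : ℂ) := by
  refine hf.ofReal.bdd_mul (c := 1) ?_ (.of_forall fun x => (norm_exp_neg_I_mul _).le)
  exact Continuous.aestronglyMeasurable (by fun_prop)

/-- Decay of the Fourier transform of a Lipschitz function with bounded support. -/
lemma norm_mul_norm_fourier_le {f : Space d → ℝ} {R L : ℝ} (hf : Integrable f)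
    (hR : ∀ x, R < ‖x‖ → f x = 0) (hL : ∀ x y, |f x - f y| ≤ L * ‖x - y‖)
    {ξ : Space d} (hξ : 1 ≤ ‖ξ‖) :
    ‖ξ‖ * ‖fourier f ξ‖ ≤
      L * Real.pi * volume.real (Metric.closedBall (0 : Space d) (R + Real.pi)) := by
  have hpi := Real.pi_pos
  have hξ0 : 0 < ‖ξ‖ := by linarith
  -- This shift satisfies `⟨ξ, h⟩ = π`, so translating by it flips the sign of the phase and twice
  -- the transform of `f` is the transform of `f - f(· + h)`. The Lipschitz bound then yields `‖h‖ =
  -- π/‖ξ‖`, and `1 ≤ ‖ξ‖` keeps the support in radius `R + π`.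
  set h : Space d := (Real.pi / ‖ξ‖ ^ 2) • ξ with hh
  have hin : inner ℝ ξ h = Real.pi := by
    rw [hh, real_inner_smul_right, real_inner_self_eq_norm_sq]
    field_simp
  have hnorm : ‖h‖ = Real.pi / ‖ξ‖ := by
    rw [hh, norm_smul, Real.norm_of_nonneg (by positivity)]
    field_simp
  have hnle : ‖h‖ ≤ Real.pi := by
    rw [hnorm]; exact div_le_self hpi.le hξ
  have h1 : fourier f ξ = -fourier (fun x => f (x + h)) ξ := by
    unfold fourier
    rw [← integral_add_right_eq_self _ h, ← integral_neg]
    congr 1 with x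
    rw [inner_add_right, hin]
    have : -(Complex.I * ((inner ℝ ξ x + Real.pi : ℝ) : ℂ)) =
        -(Complex.I * ((inner ℝ ξ x : ℝ) : ℂ)) - Real.pi * Complex.I := by push_cast; ring
    rw [this, Complex.exp_sub, Complex.exp_pi_mul_I]
    ring
  have h2 : fourier f ξ + fourier f ξ = fourier (fun x => f x - f (x + h)) ξ := by
    nth_rewrite 2 [h1]
    rw [← sub_eq_add_neg]
    unfold fourier
    rw [← integral_sub (integrable_exp_mul hf ξ) (integrable_exp_mul (hf.comp_add_right h) ξ)]
    congr 1 with x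
    push_cast
    ring
  have h3 := norm_fourier_le (f := fun x => f x - f (x + h)) (R := R + Real.pi) (A := L * ‖h‖)
    (fun x hx => by
      have h4 : ‖x‖ ≤ ‖x + h‖ + ‖h‖ := by
        simpa using norm_sub_le (x + h) h
      rw [hR x (by linarith), hR (x + h) (by linarith), sub_zero])
    (fun x => by simpa using hL x (x + h)) ξ
  rw [← h2, ← two_mul, norm_mul, Complex.norm_two, hnorm] at h3
  set v := volume.real (Metric.closedBall (0 : Space d) (R + Real.pi)) with hv
  have hv0 : 0 ≤ v := measureReal_nonneg
  calc ‖ξ‖ * ‖fourier f ξ‖ ≤ ‖ξ‖ * (2 * ‖fourier f ξ‖) := by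
        gcongr; linarith [norm_nonneg (fourier f ξ)]
    _ ≤ ‖ξ‖ * (L * (Real.pi / ‖ξ‖) * v) := by gcongr
    _ = L * Real.pi * v := by field_simp

/-- Square decay of the spatial Fourier transform of a test function. -/
lemma TestFunction.exists_norm_fourier_sq_le (φ : TestFunction d) :
    ∃ C R : ℝ, 0 ≤ C ∧ ∀ t ξ, ‖fourier (φ.toFun t) ξ‖ ^ 2 ≤
      (Set.Icc (-R) R).indicator (fun _ => C) t * (1 / (1 + ‖ξ‖ ^ 2)) := by
  obtain ⟨R, A, L, hR0, hA0, hL0, hR, hA, hL⟩ := φ.exists_bounds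
  set a := A * volume.real (Metric.closedBall (0 : Space d) R) with ha
  set c := L * Real.pi * volume.real (Metric.closedBall (0 : Space d) (R + Real.pi)) with hc
  have ha0 : 0 ≤ a := by positivity
  have hpi := Real.pi_pos
  have hc0 : 0 ≤ c := by positivity
  -- Low frequencies need `2a²`, since `1 + ‖ξ‖² ≤ 2` there; high frequencies need `a² + c²`.
  refine ⟨2 * a ^ 2 + c ^ 2, R, by positivity, fun t ξ => ?_⟩
  have hnn := norm_nonneg (fourier (φ.toFun t) ξ)
  by_cases ht : t ∈ Set.Icc (-R) R
  · rw [Set.indicator_of_mem ht, mul_one_div, le_div_iff₀ (by positivity)]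
    have h1 : ‖fourier (φ.toFun t) ξ‖ ≤ a :=
      norm_fourier_le (fun x hx => hR t x (Or.inr hx)) (hA t) ξ
    have h2 : ‖fourier (φ.toFun t) ξ‖ ^ 2 ≤ a ^ 2 := by gcongr
    rcases le_total ‖ξ‖ 1 with hξ | hξ
    · have h3 : ‖ξ‖ ^ 2 ≤ 1 := pow_le_one₀ (norm_nonneg _) hξ
      calc _ ≤ a ^ 2 * (1 + 1) := by gcongr
        _ ≤ _ := by nlinarith [sq_nonneg c]
    · have hint : Integrable (φ.toFun t) := by
        refine Measure.integrableOn_of_bounded (s := Metric.closedBall 0 R) (M := A)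
          (isCompact_closedBall _ _).measure_lt_top.ne
          (φ.measurable.comp measurable_prodMk_left).aestronglyMeasurable
          (.of_forall (hA t)) |>.integrable_of_forall_notMem_eq_zero fun x hx =>
            hR t x (Or.inr (by simpa using hx))
      have h3 := norm_mul_norm_fourier_le hint (fun x hx => hR t x (Or.inr hx)) (hL t) hξ
      have h4 : (‖ξ‖ * ‖fourier (φ.toFun t) ξ‖) ^ 2 ≤ c ^ 2 := by gcongr
      nlinarith [sq_nonneg a]
  · rw [Set.indicator_of_notMem ht, zero_mul]
    have : φ.toFun t = fun _ => 0 := by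
      funext x
      refine hR t x (Or.inl ?_)
      by_contra hlt
      exact ht (abs_le.1 (not_lt.1 hlt))
    rw [this]
    simp [fourier]

/-- Since `q < 2`, the quadratic Fourier decay of test functions is dominated by the weight that `μ`
integrates. -/
lemma one_div_one_add_sq_le {q : ℝ} (hq : q ∈ Set.Ioo (0 : ℝ) 2) {r : ℝ} (hr : 0 ≤ r) :
    1 / (1 + r ^ 2) ≤ 2 * (1 / (1 + r ^ q)) := by
  have h1 : r ^ q ≤ 1 + r ^ 2 := by
    rcases le_total r 1 with h | h
    · exact (Real.rpow_le_one hr h hq.1.le).trans (by nlinarith [sq_nonneg r])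
    · have := Real.rpow_le_rpow_of_exponent_le h hq.2.le
      rw [Real.rpow_two] at this
      linarith
  have h2 : 0 ≤ r ^ q := by positivity
  rw [mul_one_div, div_le_div_iff₀ (by positivity) (by positivity)]
  nlinarith [sq_nonneg r]

end TestFunctions

/-! ### The isometry between the noise and its spectral representation -/

section Isometry

variable {d : ℕ} {μ : Measure (Space d)} {q : ℝ}

lemma measurable_weight (q : ℝ) : Measurable fun ξ : Space d => 1 / (1 + ‖ξ‖ ^ q) := by
  fun_prop

lemma integrable_weight
    (hμ : ∫⁻ ξ, ENNReal.ofReal (1 / (1 + ‖ξ‖ ^ q)) ∂μ < ⊤) :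
    Integrable (fun ξ : Space d => 1 / (1 + ‖ξ‖ ^ q)) μ := by
  refine ⟨(measurable_weight q).aestronglyMeasurable, ?_⟩
  rwa [hasFiniteIntegral_iff_ofReal (.of_forall fun ξ => by positivity)]

/-- The weight is bounded below on balls, so Markov's inequality makes `μ` locally finite.
σ-finiteness is what Tonelli and Fubini require for `dt μ(dξ)`. -/
lemma sigmaFinite_of_integrable_weight (hq : q ∈ Set.Ioo (0 : ℝ) 2)
    (hμ : ∫⁻ ξ, ENNReal.ofReal (1 / (1 + ‖ξ‖ ^ q)) ∂μ < ⊤) : SigmaFinite μ := by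
  have : IsLocallyFiniteMeasure μ := by
    refine ⟨fun x => ⟨Metric.ball x 1, Metric.ball_mem_nhds x one_pos, ?_⟩⟩
    set c : ℝ := 1 / (1 + (‖x‖ + 1) ^ q) with hc
    have hc0 : 0 < c := by positivity
    have h1 := mul_meas_ge_le_lintegral₀ (μ := μ)
      (measurable_weight (d := d) q).ennreal_ofReal.aemeasurable (ENNReal.ofReal c)
    have h2 : μ {ξ | ENNReal.ofReal c ≤ ENNReal.ofReal (1 / (1 + ‖ξ‖ ^ q))} < ⊤ := by
      by_contra h
      rw [not_lt_top_iff] at h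
      rw [h, ENNReal.mul_top (by simpa using hc0)] at h1
      exact absurd (h1.trans_lt hμ) (lt_irrefl _)
    refine (measure_mono fun ξ hξ => ?_).trans_lt h2
    refine ENNReal.ofReal_le_ofReal ?_
    have h3 : ‖ξ‖ ≤ ‖x‖ + 1 := by
      have := norm_le_norm_add_norm_sub' ξ x
      have h4 : ‖ξ - x‖ < 1 := by simpa [dist_eq_norm] using hξ
      linarith
    have := hq.1.le
    rw [hc]
    gcongr
  infer_instance

/-- The measure `dt μ(dξ)` on `(0, ∞) × ℝ^d`. -/
noncomputable abbrev spectralMeasure (μ : Measure (Space d)) : Measure (ℝ × Space d) :=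
  (volume.restrict (Set.Ioi (0 : ℝ))).prod μ

/-- This permits replacing the iterated integral of the covariance by one over the product measure,
and splitting it termwise. -/
lemma integrable_fourier_mul_conj (hq : q ∈ Set.Ioo (0 : ℝ) 2)
    (hμ : ∫⁻ ξ, ENNReal.ofReal (1 / (1 + ‖ξ‖ ^ q)) ∂μ < ⊤) (φ ψ : TestFunction d) :
    Integrable (fun p : ℝ × Space d => fourier (φ.toFun p.1) p.2 *
      (starRingEnd ℂ) (fourier (ψ.toFun p.1) p.2)) (spectralMeasure μ) := by
  have := sigmaFinite_of_integrable_weight hq hμ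
  have key : ∀ φ : TestFunction d, Integrable
      (fun p : ℝ × Space d => ‖fourier (φ.toFun p.1) p.2‖ ^ 2) (spectralMeasure μ) := by
    intro φ
    obtain ⟨C, R, hC, h⟩ := φ.exists_norm_fourier_sq_le
    have h1 : Integrable ((Set.Icc (-R) R).indicator fun _ => C)
        (volume.restrict (Set.Ioi (0 : ℝ))) := by
      rw [integrable_indicator_iff measurableSet_Icc]
      refine integrableOn_const ?_
      exact ((Measure.restrict_apply_le _ _).trans_lt isCompact_Icc.measure_lt_top).ne
    refine (h1.mul_prod ((integrable_weight hμ).const_mul 2)).mono'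
      ((measurable_fourier φ.measurable).norm.pow_const 2).aestronglyMeasurable
      (.of_forall fun p => ?_)
    rw [Real.norm_of_nonneg (by positivity)]
    refine (h p.1 p.2).trans ?_
    refine mul_le_mul_of_nonneg_left (one_div_one_add_sq_le hq (norm_nonneg _)) ?_
    exact Set.indicator_nonneg (fun _ _ => hC) _
  refine ((key φ).add (key ψ)).mono' ?_ (.of_forall fun p => ?_)
  · exact ((measurable_fourier φ.measurable).mul
      (Complex.continuous_conj.measurable.comp (measurable_fourier ψ.measurable))).aestronglyMeasurable
  · rw [norm_mul, RCLike.norm_conj, Pi.add_apply]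
    nlinarith [sq_nonneg (‖fourier (φ.toFun p.1) p.2‖ - ‖fourier (ψ.toFun p.1) p.2‖),
      sq_nonneg (‖fourier (φ.toFun p.1) p.2‖), sq_nonneg (‖fourier (ψ.toFun p.1) p.2‖)]

variable {Ω : Type*} [MeasurableSpace Ω] {P : Measure Ω} {W : TestFunction d → Ω → ℝ}

lemma IsHomogeneousNoise.covariance_eq_integral_prod (hW : IsHomogeneousNoise P μ W)
    (hq : q ∈ Set.Ioo (0 : ℝ) 2) (hμ : ∫⁻ ξ, ENNReal.ofReal (1 / (1 + ‖ξ‖ ^ q)) ∂μ < ⊤)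
    (φ ψ : TestFunction d) :
    ((∫ ω, W φ ω * W ψ ω ∂P : ℝ) : ℂ) =
      ∫ p, fourier (φ.toFun p.1) p.2 * (starRingEnd ℂ) (fourier (ψ.toFun p.1) p.2)
        ∂(spectralMeasure μ) := by
  have := sigmaFinite_of_integrable_weight hq hμ
  rw [hW.covariance, integral_prod _ (integrable_fourier_mul_conj hq hμ φ ψ)]

lemma integral_sub_sub_sub {α E : Type*} [MeasurableSpace α] [NormedAddCommGroup E]
    [NormedSpace ℝ E] {m : Measure α} {f₁ f₂ f₃ f₄ : α → E} (h₁ : Integrable f₁ m)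
    (h₂ : Integrable f₂ m) (h₃ : Integrable f₃ m) (h₄ : Integrable f₄ m) :
    ∫ x, (f₁ x - f₂ x - (f₃ x - f₄ x)) ∂m =
      ∫ x, f₁ x ∂m - ∫ x, f₂ x ∂m - (∫ x, f₃ x ∂m - ∫ x, f₄ x ∂m) := by
  rw [← integral_sub h₁ h₂, ← integral_sub h₃ h₄]
  exact integral_sub (h₁.sub h₂) (h₃.sub h₄)

/-- The isometry property of the noise. -/
lemma IsHomogeneousNoise.lintegral_sub_sq [IsProbabilityMeasure P]
    (hW : IsHomogeneousNoise P μ W)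
    (hq : q ∈ Set.Ioo (0 : ℝ) 2) (hμ : ∫⁻ ξ, ENNReal.ofReal (1 / (1 + ‖ξ‖ ^ q)) ∂μ < ⊤)
    (φ ψ : TestFunction d) :
    ∫⁻ ω, ‖W φ ω - W ψ ω‖ₑ ^ 2 ∂P =
      ∫⁻ p, ‖fourier (φ.toFun p.1) p.2 - fourier (ψ.toFun p.1) p.2‖ₑ ^ 2 ∂(spectralMeasure μ) := by
  have hint := integrable_fourier_mul_conj (μ := μ) hq hμ
  have hL : ∀ χ, MemLp (W χ) 2 P := fun χ => (hW.gaussian.hasGaussianLaw_eval χ).memLp_two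
  have hWi : ∀ χ χ', Integrable (fun ω => W χ ω * W χ' ω) P := fun χ χ' =>
    (hL χ).integrable_mul (hL χ')
  set F := fun p : ℝ × Space d => fourier (φ.toFun p.1) p.2 with hF
  set G := fun p : ℝ × Space d => fourier (ψ.toFun p.1) p.2 with hG
  -- Linearity of `W` is not assumed: both squares are expanded into four products, which the
  -- covariance identity matches one by one in `ℂ`.
  have hexp : ∀ p, ((‖F p - G p‖ ^ 2 : ℝ) : ℂ) =
      F p * (starRingEnd ℂ) (F p) - F p * (starRingEnd ℂ) (G p) -
        (G p * (starRingEnd ℂ) (F p) - G p * (starRingEnd ℂ) (G p)) := by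
    intro p
    push_cast
    rw [← Complex.mul_conj', map_sub]
    ring
  have hcint : Integrable (fun p => ((‖F p - G p‖ ^ 2 : ℝ) : ℂ)) (spectralMeasure μ) := by
    simp_rw [hexp]
    exact ((hint φ φ).sub (hint φ ψ)).sub ((hint ψ φ).sub (hint ψ ψ))
  have hrint : Integrable (fun p => ‖F p - G p‖ ^ 2) (spectralMeasure μ) := by
    simpa only [RCLike.re_eq_complex_re, Complex.ofReal_re] using hcint.re
  have hWexp : ∀ ω, (W φ ω - W ψ ω) ^ 2 = W φ ω * W φ ω - W φ ω * W ψ ω -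
      (W ψ ω * W φ ω - W ψ ω * W ψ ω) := fun ω => by ring
  have hWint : Integrable (fun ω => (W φ ω - W ψ ω) ^ 2) P := by
    simp_rw [hWexp]
    exact ((hWi φ φ).sub (hWi φ ψ)).sub ((hWi ψ φ).sub (hWi ψ ψ))
  have main : ∫ ω, (W φ ω - W ψ ω) ^ 2 ∂P = ∫ p, ‖F p - G p‖ ^ 2 ∂(spectralMeasure μ) := by
    apply Complex.ofReal_injective
    rw [← integral_complex_ofReal (f := fun p => ‖F p - G p‖ ^ 2)]
    simp_rw [hexp, hWexp]
    rw [integral_sub_sub_sub (hWi φ φ) (hWi φ ψ) (hWi ψ φ) (hWi ψ ψ),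
      integral_sub_sub_sub (hint φ φ) (hint φ ψ) (hint ψ φ) (hint ψ ψ)]
    push_cast
    simp only [hW.covariance_eq_integral_prod hq hμ]
  have e1 : ∀ ω, ‖W φ ω - W ψ ω‖ₑ ^ 2 = ENNReal.ofReal ((W φ ω - W ψ ω) ^ 2) := fun ω => by
    rw [← sq_abs, ENNReal.ofReal_pow (abs_nonneg _), Real.enorm_eq_ofReal_abs]
  have e2 : ∀ p, ‖F p - G p‖ₑ ^ 2 = ENNReal.ofReal (‖F p - G p‖ ^ 2) := fun p => by
    rw [ENNReal.ofReal_pow (norm_nonneg _), ofReal_norm]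
  simp_rw [e1]
  rw [← ofReal_integral_eq_lintegral_ofReal hWint (.of_forall fun _ => sq_nonneg _), main,
    ofReal_integral_eq_lintegral_ofReal hrint (.of_forall fun _ => sq_nonneg _)]
  exact lintegral_congr fun p => (e2 p).symm

end Isometry

/-! ### Gaussian moments of differences of Wiener integrals -/

section Moments

variable {Ω : Type*} [MeasurableSpace Ω] {P : Measure Ω}

/-- The even moments of a centered Gaussian random variable are controlled by its variance. -/
lemma lintegral_pow_of_hasGaussianLaw {Z : Ω → ℝ} (hZ : HasGaussianLaw Z P)
    (h0 : ∫ ω, Z ω ∂P = 0) (k : ℕ) :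
    ∫⁻ ω, ‖Z ω‖ₑ ^ (2 * k) ∂P =
      (∫⁻ x, ‖x‖ₑ ^ (2 * k) ∂(gaussianReal 0 1)) * (∫⁻ ω, ‖Z ω‖ₑ ^ 2 ∂P) ^ k := by
  have := hZ.isProbabilityMeasure
  have hZm := hZ.aemeasurable
  set v := Var[Z; P] with hv
  have hv0 : 0 ≤ v := variance_nonneg _ _
  have hvar : ∫⁻ ω, ‖Z ω‖ₑ ^ 2 ∂P = ENNReal.ofReal v := by
    have h1 := ofReal_variance hZ.memLp_two
    rw [← hv, evariance, h0] at h1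
    simpa using h1.symm
  -- Writing the law as a scaled standard Gaussian also covers the degenerate case `v = 0`.
  have hmap : P.map Z = (gaussianReal 0 1).map (√v * ·) := by
    rw [hZ.map_eq_gaussianReal, h0, gaussianReal_map_const_mul, mul_zero, mul_one]
    congr 1
    ext
    simp [hv]
  have hmeas : ∀ j : ℕ, Measurable fun x : ℝ => ‖x‖ₑ ^ j := fun j => by fun_prop
  rw [hvar, ← lintegral_map' (f := fun x : ℝ => ‖x‖ₑ ^ (2 * k)) (hmeas _).aemeasurable hZm, hmap,
    lintegral_map (hmeas _) (by fun_prop)]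
  simp_rw [enorm_mul, mul_pow]
  rw [lintegral_const_mul _ (hmeas _), mul_comm]
  congr 1
  rw [Real.enorm_eq_ofReal (Real.sqrt_nonneg _), pow_mul, ← ENNReal.ofReal_pow (Real.sqrt_nonneg _),
    Real.sq_sqrt hv0]

lemma lintegral_pow_gaussianReal_ne_top (k : ℕ) :
    ∫⁻ x, ‖x‖ₑ ^ (2 * k) ∂(gaussianReal 0 1) ≠ ⊤ := by
  rcases Nat.eq_zero_or_pos k with rfl | hk
  · simp
  have h := (memLp_id_gaussianReal' (μ := 0) (v := 1) ((2 * k : ℕ) : ℝ≥0∞) (ENNReal.natCast_ne_top _)).2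
  rw [eLpNorm_lt_top_iff_lintegral_rpow_enorm_lt_top (by simp; omega) (ENNReal.natCast_ne_top _)]
    at h
  simp only [ENNReal.toReal_natCast, ENNReal.rpow_natCast, id] at h
  exact h.ne

lemma enorm_add_sq_le {E : Type*} [SeminormedAddCommGroup E] (x y : E) :
    ‖x + y‖ₑ ^ 2 ≤ 2 * ‖x‖ₑ ^ 2 + 2 * ‖y‖ₑ ^ 2 := by
  rw [← ofReal_norm, ← ofReal_norm, ← ofReal_norm, ← ENNReal.ofReal_pow (norm_nonneg _),
    ← ENNReal.ofReal_pow (norm_nonneg _), ← ENNReal.ofReal_pow (norm_nonneg _),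
    ← ENNReal.ofReal_ofNat, ← ENNReal.ofReal_mul (by norm_num), ← ENNReal.ofReal_mul (by norm_num),
    ← ENNReal.ofReal_add (by positivity) (by positivity)]
  refine ENNReal.ofReal_le_ofReal ?_
  have h1 := norm_add_le x y
  have h2 := norm_nonneg (x + y)
  nlinarith [sq_nonneg (‖x‖ - ‖y‖)]

lemma enorm_sub_sq_le {E : Type*} [SeminormedAddCommGroup E] (x y : E) :
    ‖x - y‖ₑ ^ 2 ≤ 2 * ‖x‖ₑ ^ 2 + 2 * ‖y‖ₑ ^ 2 := by
  rw [sub_eq_add_neg, ← enorm_neg y]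
  exact enorm_add_sq_le _ _

lemma measurable_enorm_sub_sq {α E : Type*} [MeasurableSpace α] [NormedAddCommGroup E]
    [MeasurableSpace E] [BorelSpace E] [SecondCountableTopology E] {f g : α → E}
    (hf : Measurable f) (hg : Measurable g) : Measurable fun x => ‖f x - g x‖ₑ ^ 2 :=
  (hf.sub hg).enorm.pow_const 2

variable {d : ℕ} {μ : Measure (Space d)} {q : ℝ} {W : TestFunction d → Ω → ℝ}

/-- Moments of the difference of two Wiener integrals. -/
lemma lintegral_wienerIntegral_sub_pow_le [IsProbabilityMeasure P]
    (hW : IsHomogeneousNoise P μ W)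
    (hq : q ∈ Set.Ioo (0 : ℝ) 2) (hμ : ∫⁻ ξ, ENNReal.ofReal (1 / (1 + ‖ξ‖ ^ q)) ∂μ < ⊤)
    {g₁ g₂ : ℝ → Space d → ℝ} {V₁ V₂ : Ω → ℝ}
    (h₁ : IsWienerIntegral P μ W g₁ V₁) (h₂ : IsWienerIntegral P μ W g₂ V₂)
    (hg₁ : Measurable fun p : ℝ × Space d => fourier (g₁ p.1) p.2)
    (hg₂ : Measurable fun p : ℝ × Space d => fourier (g₂ p.1) p.2) (k : ℕ) :
    ∫⁻ ω, ‖V₁ ω - V₂ ω‖ₑ ^ (2 * k) ∂P ≤ (∫⁻ x, ‖x‖ₑ ^ (2 * k) ∂(gaussianReal 0 1)) *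
      (2 * ∫⁻ p, ‖fourier (g₁ p.1) p.2 - fourier (g₂ p.1) p.2‖ₑ ^ 2 ∂(spectralMeasure μ)) ^ k := by
  have := sigmaFinite_of_integrable_weight hq hμ
  obtain ⟨hV₁, -, φ, hφ, hφV⟩ := h₁
  obtain ⟨hV₂, -, ψ, hψ, hψV⟩ := h₂
  set M := ∫⁻ x, ‖x‖ₑ ^ (2 * k) ∂(gaussianReal 0 1) with hM
  have hMtop : M ≠ ⊤ := lintegral_pow_gaussianReal_ne_top k
  set B := ∫⁻ p, ‖fourier (g₁ p.1) p.2 - fourier (g₂ p.1) p.2‖ₑ ^ 2 ∂(spectralMeasure μ) with hB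
  have hmF : ∀ χ : TestFunction d, Measurable fun p : ℝ × Space d => fourier (χ.toFun p.1) p.2 :=
    fun χ => measurable_fourier χ.measurable
  have hprod : ∀ (χ : TestFunction d) {g : ℝ → Space d → ℝ}
      (_ : Measurable fun p : ℝ × Space d => fourier (g p.1) p.2),
      ∫⁻ t in Set.Ioi (0 : ℝ), ∫⁻ ξ, ‖fourier (χ.toFun t) ξ - fourier (g t) ξ‖ₑ ^ 2 ∂μ =
      ∫⁻ p, ‖fourier (χ.toFun p.1) p.2 - fourier (g p.1) p.2‖ₑ ^ 2 ∂(spectralMeasure μ) := by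
    intro χ g hg
    rw [lintegral_prod _ (measurable_enorm_sub_sq (hmF χ) hg).aemeasurable]
  simp_rw [hprod _ hg₁] at hφ
  simp_rw [hprod _ hg₂] at hψ
  set A := fun j => ∫⁻ p, ‖fourier ((φ j).toFun p.1) p.2 - fourier (g₁ p.1) p.2‖ₑ ^ 2
    ∂(spectralMeasure μ)
  set C := fun j => ∫⁻ p, ‖fourier ((ψ j).toFun p.1) p.2 - fourier (g₂ p.1) p.2‖ₑ ^ 2
    ∂(spectralMeasure μ)
  -- The factor 2 comes from `‖x + y‖² ≤ 2‖x‖² + 2‖y‖²`, which separates `g₁ - g₂` from the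
  -- approximation errors. It is not sharp but harmless for Kolmogorov's criterion.
  have hvar : ∀ j, ∫⁻ ω, ‖W (φ j) ω - W (ψ j) ω‖ₑ ^ 2 ∂P ≤ 2 * B + (4 * A j + 4 * C j) := by
    intro j
    rw [hW.lintegral_sub_sq hq hμ, hB, ← lintegral_const_mul _ (measurable_enorm_sub_sq hg₁ hg₂),
      ← lintegral_const_mul _ (measurable_enorm_sub_sq (hmF _) hg₁),
      ← lintegral_const_mul _ (measurable_enorm_sub_sq (hmF _) hg₂),
      ← lintegral_add_left ((measurable_enorm_sub_sq (hmF _) hg₁).const_mul _),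
      ← lintegral_add_left ((measurable_enorm_sub_sq hg₁ hg₂).const_mul _)]
    refine lintegral_mono fun p => ?_
    have e : fourier ((φ j).toFun p.1) p.2 - fourier ((ψ j).toFun p.1) p.2 =
      (fourier (g₁ p.1) p.2 - fourier (g₂ p.1) p.2) +
        ((fourier ((φ j).toFun p.1) p.2 - fourier (g₁ p.1) p.2) -
          (fourier ((ψ j).toFun p.1) p.2 - fourier (g₂ p.1) p.2)) := by ring
    rw [e]
    refine (enorm_add_sq_le _ _).trans (add_le_add le_rfl ?_)
    refine (mul_le_mul_right (enorm_sub_sq_le _ _) 2).trans_eq ?_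
    rw [mul_add, ← mul_assoc, ← mul_assoc]
    norm_num
  have hlim : Tendsto (fun j => M * (2 * B + (4 * A j + 4 * C j)) ^ k) atTop
      (𝓝 (M * (2 * B + (4 * 0 + 4 * 0)) ^ k)) := by
    refine ENNReal.Tendsto.const_mul (ENNReal.Tendsto.pow (tendsto_const_nhds.add
      ((ENNReal.Tendsto.const_mul hφ (Or.inr (by simp))).add
        (ENNReal.Tendsto.const_mul hψ (Or.inr (by simp)))))) (Or.inr hMtop)
  rw [mul_zero, add_zero, add_zero] at hlim
  have hmeasure : TendstoInMeasure P (fun j ω => W (φ j) ω - W (ψ j) ω) atTop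
      (fun ω => V₁ ω - V₂ ω) := by
    refine tendstoInMeasure_of_tendsto_eLpNorm (p := 2) (by simp)
      (fun j => ((hW.measurable _).sub (hW.measurable _)).aestronglyMeasurable)
      (hV₁.sub hV₂).aestronglyMeasurable ?_
    have h2 : Tendsto (fun j => ∫⁻ ω, ‖(W (φ j) ω - W (ψ j) ω) - (V₁ ω - V₂ ω)‖ₑ ^ 2 ∂P) atTop
        (𝓝 0) := by
      have h3 : Tendsto (fun j => 2 * ∫⁻ ω, ‖W (φ j) ω - V₁ ω‖ₑ ^ 2 ∂P +
          2 * ∫⁻ ω, ‖W (ψ j) ω - V₂ ω‖ₑ ^ 2 ∂P) atTop (𝓝 (2 * 0 + 2 * 0)) :=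
        (ENNReal.Tendsto.const_mul hφV (Or.inr (by simp))).add
          (ENNReal.Tendsto.const_mul hψV (Or.inr (by simp)))
      rw [mul_zero, add_zero] at h3
      refine tendsto_of_tendsto_of_tendsto_of_le_of_le tendsto_const_nhds h3 (fun _ => zero_le)
        fun j => ?_
      simp only
      have hm1 := measurable_enorm_sub_sq (hW.measurable (φ j)) hV₁
      have hm2 := measurable_enorm_sub_sq (hW.measurable (ψ j)) hV₂
      rw [← lintegral_const_mul _ hm1, ← lintegral_const_mul _ hm2,
        ← lintegral_add_left (hm1.const_mul _)]
      refine lintegral_mono fun ω => ?_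
      simp only
      rw [sub_sub_sub_comm]
      exact enorm_sub_sq_le _ _
    have h4 := h2.ennrpow_const (1 / 2 : ℝ)
    rw [ENNReal.zero_rpow_of_pos (by norm_num)] at h4
    refine h4.congr fun j => ?_
    rw [eLpNorm_eq_lintegral_rpow_enorm_toReal (by simp) (by simp)]
    simp
  -- Almost sure convergence along a subsequence and Fatou's lemma carry the moment bound to the
  -- limit, so `V₁ - V₂` need not be shown Gaussian.
  obtain ⟨ns, hns, hae⟩ := hmeasure.exists_seq_tendsto_ae
  calc ∫⁻ ω, ‖V₁ ω - V₂ ω‖ₑ ^ (2 * k) ∂P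
      ≤ ∫⁻ ω, liminf (fun j => ‖W (φ (ns j)) ω - W (ψ (ns j)) ω‖ₑ ^ (2 * k)) atTop ∂P := by
        refine lintegral_mono_ae ?_
        filter_upwards [hae] with ω hω
        exact (ENNReal.Tendsto.pow hω.enorm).liminf_eq.ge
    _ ≤ liminf (fun j => ∫⁻ ω, ‖W (φ (ns j)) ω - W (ψ (ns j)) ω‖ₑ ^ (2 * k) ∂P) atTop :=
        lintegral_liminf_le fun j =>
          ((hW.measurable _).sub (hW.measurable _)).enorm.pow_const (2 * k)
    _ ≤ liminf (fun j => M * (2 * B + (4 * A (ns j) + 4 * C (ns j))) ^ k) atTop := by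
        refine liminf_le_liminf (.of_forall fun j => ?_)
        have hc : ∫ ω, (W (φ (ns j)) ω - W (ψ (ns j)) ω) ∂P = 0 := by
          rw [integral_sub (hW.gaussian.hasGaussianLaw_eval _).integrable
            (hW.gaussian.hasGaussianLaw_eval _).integrable, hW.centered, hW.centered, sub_zero]
        rw [lintegral_pow_of_hasGaussianLaw hW.gaussian.hasGaussianLaw_fun_sub hc]
        gcongr
        exact hvar _
    _ = _ := (hlim.comp hns.tendsto_atTop).liminf_eq

end Moments

/-! ### Hölder estimate for the stochastic convolution in the spectral norm -/

section SpectralEstimate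

variable {d : ℕ}

lemma measurable_convIntegrand (t : ℝ) (x : Space d) :
    Measurable fun p : ℝ × Space d => convIntegrand t x p.1 p.2 := by
  unfold convIntegrand
  refine Measurable.ite ?_ ?_ measurable_const
  · exact (measurableSet_le measurable_const measurable_fst).inter
      (measurableSet_lt measurable_fst measurable_const)
  · exact measurable_heatKernel.comp (f := fun p : ℝ × Space d => (t - p.1, x - p.2)) (by fun_prop)

lemma fourier_convIntegrand (t : ℝ) (x : Space d) {s : ℝ} (hs : 0 ≤ s) (ξ : Space d) :
    fourier (convIntegrand t x s) ξ = if s < t then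
      Complex.exp (-(Complex.I * ((inner ℝ ξ x : ℝ) : ℂ))) *
        ((Real.exp (-((t - s) * ‖ξ‖ ^ 2 / 2)) : ℝ) : ℂ) else 0 := by
  split_ifs with h
  · have : convIntegrand t x s = fun y => heatKernel (t - s) (x - y) := by
      funext y; simp [convIntegrand, hs, h]
    rw [this, fourier_heatKernel_sub (by linarith)]
  · have : convIntegrand t x s = fun y => 0 := by
      funext y; simp [convIntegrand, h]
    rw [this]
    simp [fourier]

/-- The interpolation that shares one bound between smallness in the increment and decay in the
frequency. -/
lemma min_le_rpow_mul_rpow {η a c : ℝ} (hη : η ∈ Set.Icc (0 : ℝ) 1) (ha : 0 ≤ a) (hc : 0 ≤ c) :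
    min a c ≤ a ^ η * c ^ (1 - η) := by
  have h0 : 0 ≤ min a c := le_min ha hc
  calc min a c = min a c ^ η * min a c ^ (1 - η) := by
        rw [← Real.rpow_add' h0 (by norm_num), add_sub_cancel, Real.rpow_one]
    _ ≤ _ := by
        have h1 := hη.1
        have h2 : 0 ≤ 1 - η := by linarith [hη.2]
        gcongr
        · exact min_le_left _ _
        · exact min_le_right _ _

lemma min_one_le_rpow {η a : ℝ} (hη : η ∈ Set.Icc (0 : ℝ) 1) (ha : 0 ≤ a) :
    min a 1 ≤ a ^ η := by
  simpa using min_le_rpow_mul_rpow hη ha zero_le_one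

/-- Replacing the rate `l` by `1 + l` costs at most `exp T`, as `c - s ≤ T`, and avoids the blow-up
of `1/l` at low frequencies. -/
lemma lintegral_exp_le {T a c l : ℝ} (hac : a ≤ c) (hT : c - a ≤ T) (hl : 0 ≤ l) :
    ∫⁻ s in Set.Ico a c, ENNReal.ofReal (Real.exp (-((c - s) * l))) ≤
      ENNReal.ofReal (Real.exp T * min (c - a) (1 / (1 + l))) := by
  have hT0 : 0 ≤ T := by linarith
  have h1 : ∫⁻ s in Set.Ico a c, ENNReal.ofReal (Real.exp (-((c - s) * l))) ≤
      ENNReal.ofReal (Real.exp T * (c - a)) := by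
    calc _ ≤ ∫⁻ s in Set.Ico a c, ENNReal.ofReal (Real.exp T) := by
          refine setLIntegral_mono measurable_const fun s hs => ?_
          refine ENNReal.ofReal_le_ofReal (Real.exp_le_exp.2 ?_)
          have : 0 ≤ (c - s) * l := mul_nonneg (by linarith [hs.2]) hl
          linarith
      _ = _ := by
          rw [setLIntegral_const, Real.volume_Ico, ENNReal.ofReal_mul (by positivity)]
  have h2 : ∫⁻ s in Set.Ico a c, ENNReal.ofReal (Real.exp (-((c - s) * l))) ≤
      ENNReal.ofReal (Real.exp T * (1 / (1 + l))) := by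
    have hd : ∀ s ∈ Set.uIcc a c, HasDerivAt
        (fun s => Real.exp T * (Real.exp (-((c - s) * (1 + l))) / (1 + l)))
        (Real.exp T * Real.exp (-((c - s) * (1 + l)))) s := by
      intro s _
      have h3 : HasDerivAt (fun s => -((c - s) * (1 + l))) (1 + l) s :=
        (((hasDerivAt_id' s).const_sub c).mul_const (1 + l)).fun_neg.congr_deriv (by ring)
      have h4 := (h3.exp.div_const (1 + l)).const_mul (Real.exp T)
      have hne : 1 + l ≠ 0 := by positivity
      rwa [mul_div_assoc, div_self hne, mul_one] at h4
    have hcont : Continuous fun s => Real.exp T * Real.exp (-((c - s) * (1 + l))) := by fun_prop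
    have hint := intervalIntegral.integral_eq_sub_of_hasDerivAt hd
      (hcont.intervalIntegrable a c)
    calc _ ≤ ∫⁻ s in Set.Ioc a c, ENNReal.ofReal (Real.exp T * Real.exp (-((c - s) * (1 + l)))) := by
          rw [setLIntegral_congr Ico_ae_eq_Ioc]
          refine setLIntegral_mono (by fun_prop) fun s hs => ?_
          rw [← Real.exp_add]
          refine ENNReal.ofReal_le_ofReal (Real.exp_le_exp.2 ?_)
          linarith [hs.1]
      _ = ENNReal.ofReal (∫ s in a..c, Real.exp T * Real.exp (-((c - s) * (1 + l)))) := by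
          rw [intervalIntegral.integral_of_le hac, ofReal_integral_eq_lintegral_ofReal]
          · exact (hcont.intervalIntegrable a c).1
          · exact .of_forall fun s => by positivity
      _ ≤ _ := by
          rw [hint, sub_self, zero_mul, neg_zero, Real.exp_zero]
          refine ENNReal.ofReal_le_ofReal ?_
          have : 0 ≤ Real.exp T * (Real.exp (-((c - a) * (1 + l))) / (1 + l)) := by positivity
          linarith
  rcases le_total (c - a) (1 / (1 + l)) with h | h
  · rwa [min_eq_left h]
  · rwa [min_eq_right h]

lemma norm_exp_neg_I_mul_sub_le (a c : ℝ) :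
    ‖Complex.exp (-(Complex.I * (a : ℂ))) - Complex.exp (-(Complex.I * (c : ℂ)))‖ ≤ |a - c| := by
  have h : Complex.exp (-(Complex.I * (a : ℂ))) - Complex.exp (-(Complex.I * (c : ℂ))) =
      Complex.exp (-(Complex.I * (c : ℂ))) * (Complex.exp (Complex.I * ((c - a : ℝ) : ℂ)) - 1) := by
    rw [mul_sub, ← Complex.exp_add, mul_one]
    congr 2
    push_cast
    ring
  rw [h, norm_mul, norm_exp_neg_I_mul, one_mul, abs_sub_comm]
  exact Real.norm_exp_I_mul_ofReal_sub_one_le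

/-- The difference of phases is at most `2` and at most `δ(1 + ‖ξ‖²)`. Its square is therefore at
most `4 min (δ(1 + ‖ξ‖²)) 1`, which is then interpolated. -/
lemma norm_exp_neg_I_mul_sub_sq_le {η : ℝ} (hη : η ∈ Set.Icc (0 : ℝ) 1) (x x' ξ : Space d) {δ : ℝ}
    (hδ : ‖x - x'‖ ≤ δ) :
    ‖Complex.exp (-(Complex.I * ((inner ℝ ξ x : ℝ) : ℂ))) -
      Complex.exp (-(Complex.I * ((inner ℝ ξ x' : ℝ) : ℂ)))‖ ^ 2 ≤
        4 * (δ ^ η * (1 + ‖ξ‖ ^ 2) ^ η) := by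
  set z := ‖Complex.exp (-(Complex.I * ((inner ℝ ξ x : ℝ) : ℂ))) -
      Complex.exp (-(Complex.I * ((inner ℝ ξ x' : ℝ) : ℂ)))‖ with hz
  have hδ0 : 0 ≤ δ := (norm_nonneg _).trans hδ
  have h0 : 0 ≤ z := norm_nonneg _
  have h1 : z ≤ 2 := by
    refine (norm_sub_le _ _).trans_eq ?_
    rw [norm_exp_neg_I_mul, norm_exp_neg_I_mul]; norm_num
  have h2 : z ≤ δ * (1 + ‖ξ‖ ^ 2) := by
    refine (norm_exp_neg_I_mul_sub_le _ _).trans ?_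
    rw [← inner_sub_right]
    refine (abs_real_inner_le_norm _ _).trans ?_
    rw [mul_comm]
    gcongr
    nlinarith [sq_nonneg (‖ξ‖ - 1), norm_nonneg ξ]
  have h3 := min_one_le_rpow hη (a := δ * (1 + ‖ξ‖ ^ 2)) (by positivity)
  rw [Real.mul_rpow hδ0 (by positivity)] at h3
  refine le_trans ?_ (mul_le_mul_of_nonneg_left h3 (by norm_num))
  rw [mul_min_of_nonneg _ _ (by norm_num)]
  exact le_min (by nlinarith) (by nlinarith)

lemma one_sub_exp_sq_le {η : ℝ} (hη : η ∈ Set.Icc (0 : ℝ) 1) {h δ l : ℝ} (h0 : 0 ≤ h) (hδ : h ≤ δ)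
    (hl : 0 ≤ l) : (1 - Real.exp (-(h * l / 2))) ^ 2 ≤ δ ^ η * (1 + l) ^ η := by
  have h1 : Real.exp (-(h * l / 2)) ≤ 1 := Real.exp_le_one_iff.2 (by
    have : 0 ≤ h * l := by positivity
    linarith)
  have h2 := Real.exp_pos (-(h * l / 2))
  have h3 := Real.add_one_le_exp (-(h * l / 2))
  have hδ0 : 0 ≤ δ := h0.trans hδ
  have h5 : h * l ≤ δ * (1 + l) := by
    have : l ≤ 1 + l := by linarith
    gcongr
  have h6 : 0 ≤ h * l := by positivity
  rw [← Real.mul_rpow hδ0 (by positivity)]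
  refine le_trans (le_min ?_ ?_) (min_one_le_rpow hη (a := δ * (1 + l)) (by positivity)) <;>
  nlinarith

/-- The time integral of the squared increments of the Fourier transform of the heat kernel. -/
lemma lintegral_fourier_convIntegrand_sub_sq_le {T η : ℝ} (hη : η ∈ Set.Icc (0 : ℝ) 1)
    {t t' : ℝ} (ht' : 0 ≤ t') (htt : t' ≤ t) (htT : t ≤ T) (x x' ξ : Space d) {δ : ℝ}
    (hδt : t - t' ≤ δ) (hδx : ‖x - x'‖ ≤ δ) :
    ∫⁻ s in Set.Ioi (0 : ℝ), ‖fourier (convIntegrand t x s) ξ -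
      fourier (convIntegrand t' x' s) ξ‖ₑ ^ 2 ≤
      ENNReal.ofReal (11 * Real.exp T * δ ^ η * (1 + ‖ξ‖ ^ 2) ^ (η - 1)) := by
  set l := ‖ξ‖ ^ 2 with hl
  have hl0 : 0 ≤ l := by positivity
  have hδ0 : 0 ≤ δ := (norm_nonneg _).trans hδx
  have hT0 : 0 ≤ T := by linarith
  set e := Complex.exp (-(Complex.I * ((inner ℝ ξ x : ℝ) : ℂ))) with he
  set e' := Complex.exp (-(Complex.I * ((inner ℝ ξ x' : ℝ) : ℂ))) with he'
  -- For `s < t'` the semigroup property factors the later transform through the earlier one. `A`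
  -- then bounds the squared increment relative to the earlier kernel, with one term for time and
  -- one for space.
  set A := 2 * (1 - Real.exp (-((t - t') * l / 2))) ^ 2 + 2 * ‖e - e'‖ ^ 2 with hA
  have hA0 : 0 ≤ A := by positivity
  have hAle : A ≤ 10 * (δ ^ η * (1 + l) ^ η) := by
    have h1 := one_sub_exp_sq_le hη (sub_nonneg.2 htt) hδt hl0
    have h2 := norm_exp_neg_I_mul_sub_sq_le hη x x' ξ hδx
    rw [hA]
    linarith
  -- Both kernels are present on `[0, t')`, only the later one on `[t', t)`, and none afterwards.
  have hpt : ∀ s ∈ Set.Ioi (0 : ℝ), ‖fourier (convIntegrand t x s) ξ -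
      fourier (convIntegrand t' x' s) ξ‖ₑ ^ 2 ≤
      ENNReal.ofReal A * (Set.Ico 0 t').indicator
        (fun s => ENNReal.ofReal (Real.exp (-((t' - s) * l)))) s +
      (Set.Ico t' t).indicator (fun s => ENNReal.ofReal (Real.exp (-((t - s) * l)))) s := by
    intro s hs
    have hs0 : 0 ≤ s := le_of_lt hs
    rw [fourier_convIntegrand t x hs0, fourier_convIntegrand t' x' hs0]
    rcases lt_or_ge s t' with h1 | h1
    · rw [if_pos (h1.trans_le htt), if_pos h1, Set.indicator_of_mem (Set.mem_Ico.2 ⟨hs0, h1⟩),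
        Set.indicator_of_notMem (fun h => absurd h.1 (not_le.2 h1)), add_zero,
        ← ENNReal.ofReal_mul hA0, ← ofReal_norm, ← ENNReal.ofReal_pow (norm_nonneg _)]
      refine ENNReal.ofReal_le_ofReal ?_
      set r := Real.exp (-((t' - s) * l / 2)) with hr
      set w := Real.exp (-((t - t') * l / 2)) with hw
      have hprod : Real.exp (-((t - s) * l / 2)) = w * r := by
        rw [hw, hr, ← Real.exp_add]; congr 1; ring
      have hr2 : Real.exp (-((t' - s) * l)) = r ^ 2 := by
        rw [hr, sq, ← Real.exp_add]; congr 1; ring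
      have hr0 : 0 ≤ r := (Real.exp_pos _).le
      rw [hprod, hr2]
      have e1 : e * ((w * r : ℝ) : ℂ) - e' * (r : ℂ) =
          (r : ℂ) * ((e - e') - e * ((1 - w : ℝ) : ℂ)) := by push_cast; ring
      rw [e1, norm_mul, Complex.norm_real, Real.norm_of_nonneg hr0, mul_pow, mul_comm]
      refine mul_le_mul_of_nonneg_right ?_ (sq_nonneg _)
      have e2 : ‖(e - e') - e * ((1 - w : ℝ) : ℂ)‖ ≤ ‖e - e'‖ + |1 - w| := by
        refine (norm_sub_le _ _).trans_eq ?_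
        rw [norm_mul, he, norm_exp_neg_I_mul, one_mul, Complex.norm_real, Real.norm_eq_abs]
      rw [hA, ← sq_abs (1 - w)]
      nlinarith [sq_nonneg (‖e - e'‖ - |1 - w|), norm_nonneg ((e - e') - e * ((1 - w : ℝ) : ℂ))]
    · rw [if_neg (not_lt.2 h1), sub_zero]
      split_ifs with h2
      · rw [Set.indicator_of_mem (s := Set.Ico t' t) (Set.mem_Ico.2 ⟨h1, h2⟩), ← ofReal_norm,
          ← ENNReal.ofReal_pow (norm_nonneg _), norm_mul, norm_exp_neg_I_mul, one_mul,
          Complex.norm_real, Real.norm_of_nonneg (Real.exp_pos _).le]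
        refine le_add_left (le_of_eq ?_)
        congr 1
        rw [sq, ← Real.exp_add]; congr 1; ring
      · simp
  have hmul : (1 + l) ^ η * (1 / (1 + l)) = (1 + l) ^ (η - 1) := by
    rw [Real.rpow_sub (by positivity), Real.rpow_one, mul_one_div]
  have hmeas : ∀ c : ℝ, Measurable fun s : ℝ => ENNReal.ofReal (Real.exp (-((c - s) * l))) :=
    fun c => by fun_prop
  calc _ ≤ ∫⁻ s in Set.Ioi (0 : ℝ), (ENNReal.ofReal A * (Set.Ico 0 t').indicator
        (fun s => ENNReal.ofReal (Real.exp (-((t' - s) * l)))) s +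
      (Set.Ico t' t).indicator (fun s => ENNReal.ofReal (Real.exp (-((t - s) * l)))) s) :=
        setLIntegral_mono (((((hmeas t').indicator measurableSet_Ico).const_mul _).add
          ((hmeas t).indicator measurableSet_Ico))) hpt
    _ ≤ ∫⁻ s, (ENNReal.ofReal A * (Set.Ico 0 t').indicator
        (fun s => ENNReal.ofReal (Real.exp (-((t' - s) * l)))) s +
      (Set.Ico t' t).indicator (fun s => ENNReal.ofReal (Real.exp (-((t - s) * l)))) s) :=
        setLIntegral_le_lintegral _ _
    _ = ENNReal.ofReal A *
          (∫⁻ s in Set.Ico 0 t', ENNReal.ofReal (Real.exp (-((t' - s) * l)))) +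
        ∫⁻ s in Set.Ico t' t, ENNReal.ofReal (Real.exp (-((t - s) * l))) := by
        rw [lintegral_add_right _ ((hmeas t).indicator measurableSet_Ico),
          lintegral_const_mul _ ((hmeas t').indicator measurableSet_Ico),
          lintegral_indicator measurableSet_Ico, lintegral_indicator measurableSet_Ico]
    _ ≤ ENNReal.ofReal A * ENNReal.ofReal (Real.exp T * min (t' - 0) (1 / (1 + l))) +
        ENNReal.ofReal (Real.exp T * min (t - t') (1 / (1 + l))) := by
        gcongr
        · exact lintegral_exp_le ht' (by linarith) hl0
        · exact lintegral_exp_le htt (by linarith) hl0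
    _ ≤ _ := by
        have hm0 : 0 ≤ min (t' - 0) (1 / (1 + l)) := le_min (by linarith) (by positivity)
        have hm1 : 0 ≤ min (t - t') (1 / (1 + l)) := le_min (by linarith) (by positivity)
        rw [← ENNReal.ofReal_mul hA0, ← ENNReal.ofReal_add (by positivity) (by positivity)]
        refine ENNReal.ofReal_le_ofReal ?_
        -- On `[0, t')` smallness comes from `A`, so the decay `1/(1 + l)` is used in full; on `[t',
        -- t)` it comes from the interval's length, so the minimum is interpolated. The constants
        -- add up to `10 + 1 = 11`.
        have b1 : A * (Real.exp T * min (t' - 0) (1 / (1 + l))) ≤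
            10 * (δ ^ η * (1 + l) ^ η) * (Real.exp T * (1 / (1 + l))) := by
          gcongr
          exact min_le_right _ _
        have b2 : Real.exp T * min (t - t') (1 / (1 + l)) ≤
            Real.exp T * (δ ^ η * (1 + l) ^ (η - 1)) := by
          gcongr
          refine (min_le_rpow_mul_rpow hη (sub_nonneg.2 htt) (by positivity)).trans ?_
          have : (1 / (1 + l)) ^ (1 - η) = (1 + l) ^ (η - 1) := by
            rw [one_div, Real.inv_rpow (by positivity), ← Real.rpow_neg (by positivity), neg_sub]
          rw [this]
          have := hη.1
          have := sub_nonneg.2 htt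
          gcongr
        calc _ ≤ _ := add_le_add b1 b2
          _ = 10 * Real.exp T * δ ^ η * ((1 + l) ^ η * (1 / (1 + l))) +
            Real.exp T * δ ^ η * (1 + l) ^ (η - 1) := by ring
          _ = _ := by rw [hmul]; ring

/-- Brings the power left by the time integral back to the weight in the hypothesis on `μ`. -/
lemma one_add_sq_rpow_le {q r : ℝ} (hq : 0 < q) (hr : 0 ≤ r) :
    (1 + r ^ 2) ^ (-(q / 2)) ≤ 2 * (1 / (1 + r ^ q)) := by
  have h1 : 1 ≤ (1 + r ^ 2) ^ (q / 2) := Real.one_le_rpow (by nlinarith) (by positivity)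
  have h2 : r ^ q ≤ (1 + r ^ 2) ^ (q / 2) := by
    calc r ^ q = (r ^ 2) ^ (q / 2) := by
          rw [← Real.rpow_natCast, ← Real.rpow_mul hr]; congr 1; push_cast; ring
      _ ≤ _ := by gcongr; linarith
  have h3 : 0 ≤ r ^ q := by positivity
  rw [Real.rpow_neg (by positivity), mul_one_div, ← one_div, div_le_div_iff₀ (by positivity)
    (by positivity)]
  linarith

/-- Hölder continuity of the integrand of the stochastic convolution in its parameters, in the
norm associated with the covariance of the noise. -/
lemma lintegral_spectralMeasure_convIntegrand_sub_le {μ : Measure (Space d)} {q T : ℝ}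
    (hq : q ∈ Set.Ioo (0 : ℝ) 2) (hμ : ∫⁻ ξ, ENNReal.ofReal (1 / (1 + ‖ξ‖ ^ q)) ∂μ < ⊤)
    {t t' : ℝ} (ht : t ∈ Set.Icc 0 T) (ht' : t' ∈ Set.Icc 0 T) (x x' : Space d) {δ : ℝ}
    (hδt : |t - t'| ≤ δ) (hδx : ‖x - x'‖ ≤ δ) :
    ∫⁻ p, ‖fourier (convIntegrand t x p.1) p.2 - fourier (convIntegrand t' x' p.1) p.2‖ₑ ^ 2
      ∂(spectralMeasure μ) ≤ ENNReal.ofReal (22 * Real.exp T * δ ^ (1 - q / 2)) *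
        ∫⁻ ξ, ENNReal.ofReal (1 / (1 + ‖ξ‖ ^ q)) ∂μ := by
  wlog h : t' ≤ t generalizing t t' x x'
  · have := this ht' ht x' x (by rwa [abs_sub_comm]) (by rwa [norm_sub_rev]) (le_of_not_ge h)
    simpa only [enorm_sub_rev] using this
  have := sigmaFinite_of_integrable_weight hq hμ
  have hδ0 : 0 ≤ δ := (norm_nonneg _).trans hδx
  -- This exponent turns `(1 + ‖ξ‖²)^(η - 1)` into `(1 + ‖ξ‖²)^(-q/2)`. Comparison with the weight
  -- costs a factor 2, hence `22`.
  have hη : 1 - q / 2 ∈ Set.Icc (0 : ℝ) 1 := ⟨by linarith [hq.2], by linarith [hq.1]⟩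
  rw [lintegral_prod_symm _ (measurable_enorm_sub_sq
    (measurable_fourier (measurable_convIntegrand t x))
    (measurable_fourier (measurable_convIntegrand t' x'))).aemeasurable,
    ← lintegral_const_mul _ (measurable_weight q).ennreal_ofReal]
  refine lintegral_mono fun ξ => ?_
  refine (lintegral_fourier_convIntegrand_sub_sq_le hη ht'.1 h ht.2 x x' ξ
    ((le_abs_self _).trans hδt) hδx).trans ?_
  rw [← ENNReal.ofReal_mul (by positivity)]
  refine ENNReal.ofReal_le_ofReal ?_
  have h1 := one_add_sq_rpow_le hq.1 (norm_nonneg ξ)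
  have h2 : 1 - q / 2 - 1 = -(q / 2) := by ring
  rw [h2]
  calc _ ≤ 11 * Real.exp T * δ ^ (1 - q / 2) * (2 * (1 / (1 + ‖ξ‖ ^ q))) := by gcongr
    _ = _ := by ring

end SpectralEstimate

/-! ### Continuous version of the stochastic convolution and conclusion -/

section MainTheorem

variable {d : ℕ}

/-- The spatial component of a point of `ℝ × ℝ^d`, with `ℝ^{d+1}` as parameter space. -/
noncomputable def spacePart (p : Fin (d + 1) → ℝ) : Space d :=
  WithLp.toLp 2 fun i : Fin d => p i.succ

/-- The point of `ℝ^{d+1}` with given time and space components. -/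
noncomputable def spaceTimePoint (t : ℝ) (x : Space d) : Fin (d + 1) → ℝ :=
  Fin.cons t fun i : Fin d => x i

lemma spacePart_spaceTimePoint (t : ℝ) (x : Space d) : spacePart (spaceTimePoint t x) = x := by
  ext i
  simp [spacePart, spaceTimePoint]

lemma continuous_spaceTimePoint :
    Continuous fun p : ℝ × Space d => spaceTimePoint p.1 p.2 := by
  refine continuous_pi fun i => ?_
  refine Fin.cases ?_ (fun i => ?_) i
  · simpa [spaceTimePoint] using continuous_fst
  · simp only [spaceTimePoint, Fin.cons_succ]
    fun_prop

/-- The parameter space carries the sup distance, `Space d` the Euclidean norm; `d + 1` is a crude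
bound for `√d`. -/
lemma norm_spacePart_sub_le (p p' : Fin (d + 1) → ℝ) :
    ‖spacePart p - spacePart p'‖ ≤ (d + 1) * dist p p' := by
  rw [EuclideanSpace.norm_eq, Real.sqrt_le_left (by positivity)]
  have h1 : ∀ i ∈ Finset.univ, ‖(spacePart p - spacePart p') i‖ ^ 2 ≤ dist p p' ^ 2 := by
    intro i _
    have : ‖(spacePart p - spacePart p') i‖ ≤ dist p p' := by
      simpa [spacePart, Real.dist_eq] using dist_le_pi_dist p p' i.succ
    gcongr
  refine (Finset.sum_le_card_nsmul _ _ _ h1).trans ?_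
  rw [Finset.card_univ, Fintype.card_fin, nsmul_eq_mul, mul_pow]
  gcongr
  nlinarith [(Nat.cast_nonneg d : (0 : ℝ) ≤ d)]

variable {Ω : Type*} [MeasurableSpace Ω] {P : Measure Ω} [IsProbabilityMeasure P]
  {μ : Measure (Space d)} {W : TestFunction d → Ω → ℝ} {q T : ℝ}

/-- The stochastic convolution has a continuous modification. -/
lemma exists_continuous_stochasticConvolution (hW : IsHomogeneousNoise P μ W)
    (hq : q ∈ Set.Ioo (0 : ℝ) 2) (hμ : ∫⁻ ξ, ENNReal.ofReal (1 / (1 + ‖ξ‖ ^ q)) ∂μ < ⊤)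
    (hT : 0 ≤ T) {V : ∀ t ∈ Set.Icc 0 T, Space d → Ω → ℝ}
    (hV : ∀ t ht x, IsWienerIntegral P μ W (convIntegrand t x) (V t ht x)) :
    ∃ Y : ℝ → Space d → Ω → ℝ, (∀ t x, Measurable (Y t x)) ∧
      (∀ t ht x, ∀ᵐ ω ∂P, Y t x ω = V t ht x ω) ∧
      ∀ ω, Continuous fun p : ℝ × Space d => Y p.1 p.2 ω := by
  -- Clamping time to `[0, T]`, a 1-Lipschitz operation, extends the field to all of `ℝ^(d+1)`,
  -- where the Kolmogorov theorem applies.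
  set X : (Fin (d + 1) → ℝ) → Ω → ℝ := fun p =>
    V (Set.projIcc 0 T hT (p 0)) (Set.projIcc 0 T hT (p 0)).2 (spacePart p) with hX
  set η := 1 - q / 2 with hη
  have hη0 : 0 < η := by linarith [hq.2]
  -- Chosen so that `ηk ≥ d + 2`, the number of parameters `d + 1` plus one.
  set k := ⌈((d : ℝ) + 2) / η⌉₊ with hk
  have hkη : (d : ℝ) + 2 ≤ η * k := by
    have := Nat.le_ceil (((d : ℝ) + 2) / η)
    rw [div_le_iff₀ hη0] at this
    linarith
  have hk0 : k ≠ 0 := by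
    intro h
    rw [h] at hkη
    have : (0 : ℝ) ≤ d := Nat.cast_nonneg d
    simp at hkη
    linarith
  set I := ∫⁻ ξ, ENNReal.ofReal (1 / (1 + ‖ξ‖ ^ q)) ∂μ with hI
  set M := ∫⁻ x, ‖x‖ₑ ^ (2 * k) ∂(gaussianReal 0 1) with hM
  set c : ℝ := 22 * Real.exp T * ((d : ℝ) + 1) ^ η with hc
  have hc0 : 0 ≤ c := by positivity
  have hXm : ∀ p, Measurable (X p) := fun p => (hV _ _ _).1
  have hbound : ∀ p p', dist p p' ≤ 1 → ∫⁻ ω, ‖X p ω - X p' ω‖ₑ ^ (2 * k) ∂P ≤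
      M * (2 * (ENNReal.ofReal c * I)) ^ k *
        ENNReal.ofReal (dist p p' ^ (Fintype.card (Fin (d + 1)) + 1)) := by
    intro p p' hpp
    have hδ0 : (0 : ℝ) ≤ dist p p' := dist_nonneg
    have h1 : |(Set.projIcc 0 T hT (p 0) : ℝ) - Set.projIcc 0 T hT (p' 0)| ≤
        (d + 1) * dist p p' := by
      refine (Set.abs_projIcc_sub_projIcc hT).trans ?_
      refine (dist_le_pi_dist p p' 0).trans ?_
      nlinarith [(Nat.cast_nonneg d : (0 : ℝ) ≤ d)]
    have h2 := lintegral_spectralMeasure_convIntegrand_sub_le hq hμ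
      (Set.projIcc 0 T hT (p 0)).2 (Set.projIcc 0 T hT (p' 0)).2 (spacePart p) (spacePart p') h1
      (norm_spacePart_sub_le p p')
    refine (lintegral_wienerIntegral_sub_pow_le hW hq hμ (hV _ _ _) (hV _ _ _)
      (measurable_fourier (measurable_convIntegrand _ _))
      (measurable_fourier (measurable_convIntegrand _ _)) k).trans ?_
    rw [mul_assoc]
    refine mul_le_mul_right ?_ M
    calc _ ≤ (2 * (ENNReal.ofReal (22 * Real.exp T * (((d : ℝ) + 1) * dist p p') ^ η) * I)) ^ k := by
          gcongr
      _ = (2 * (ENNReal.ofReal c * I)) ^ k * ENNReal.ofReal ((dist p p' ^ η) ^ k) := by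
          rw [Real.mul_rpow (by positivity) hδ0, ← mul_assoc (22 * Real.exp T), ENNReal.ofReal_mul hc0,
            ENNReal.ofReal_pow (by positivity), ← mul_pow]
          ring
      _ ≤ _ := by
          gcongr
          rw [← Real.rpow_natCast, ← Real.rpow_mul hδ0, ← Real.rpow_natCast]
          -- The exponent is lowered from `ηk` to `d + 2` using distance at most one; comparison of
          -- exponents needs a positive base, so distance zero is separate.
          rcases hδ0.eq_or_lt with h0 | h0
          · rw [← h0, Real.zero_rpow (by positivity), Real.zero_rpow (by positivity)]
          · refine Real.rpow_le_rpow_of_exponent_ge h0 hpp ?_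
            rw [Fintype.card_fin]
            push_cast
            linarith
  obtain ⟨Y, hYm, hYX, hYc⟩ := exists_continuous_modification hXm (by omega)
    (ENNReal.mul_ne_top (lintegral_pow_gaussianReal_ne_top k)
      (ENNReal.pow_ne_top (ENNReal.mul_ne_top (by simp)
        (ENNReal.mul_ne_top ENNReal.ofReal_ne_top hμ.ne)))) hbound
  refine ⟨fun t x => Y (spaceTimePoint t x), fun t x => hYm _, fun t ht x => ?_,
    fun ω => (hYc ω).comp continuous_spaceTimePoint⟩
  filter_upwards [hYX (spaceTimePoint t x)] with ω hω
  rw [hω]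
  have e1 : (Set.projIcc 0 T hT (spaceTimePoint t x 0) : ℝ) = t := by
    simp only [spaceTimePoint, Fin.cons_zero, Set.projIcc_of_mem hT ht]
  simp only [hX, e1, spacePart_spaceTimePoint]

end MainTheorem

end StochHeat

theorem theorem4p6 {d : ℕ} (hd : 1 ≤ d) {Ω : Type*} [MeasurableSpace Ω]
    (P : MeasureTheory.Measure Ω) [MeasureTheory.IsProbabilityMeasure P]
    (μ : MeasureTheory.Measure (StochHeat.Space d))
    (W : StochHeat.TestFunction d → Ω → ℝ) (hW : StochHeat.IsHomogeneousNoise P μ W)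
    (q : ℝ) (hq : q ∈ Set.Ioo (0 : ℝ) 2)
    (hμ : ∫⁻ ξ, ENNReal.ofReal (1 / (1 + ‖ξ‖ ^ q)) ∂μ < ⊤)
    (b : ℝ → ℝ) (hbL : ∃ K, LipschitzWith K b) (hbB : ∃ M : ℝ, ∀ r, |b r| ≤ M)
    (u₀ : StochHeat.Space d → ℝ) (hu₀m : Measurable u₀) (hu₀B : ∃ M : ℝ, ∀ x, |u₀ x| ≤ M)
    (T : ℝ) (hT : 0 < T) (u : ℝ → StochHeat.Space d → Ω → ℝ)
    (hu : StochHeat.IsMildSolution P μ W T b u₀ u) :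
    ∃ u' : ℝ → StochHeat.Space d → Ω → ℝ, StochHeat.IsModification P T u u' ∧
      ∀ ω,
        -- the sample paths are continuous at all positive times
        ContinuousOn (fun p : ℝ × StochHeat.Space d => u' p.1 p.2 ω)
          (Set.Ioc 0 T ×ˢ Set.univ) ∧
        -- and at time zero wherever the initial condition is continuous
        (∀ x, ContinuousAt u₀ x →
          ContinuousWithinAt (fun p : ℝ × StochHeat.Space d => u' p.1 p.2 ω)
            (Set.Icc 0 T ×ˢ Set.univ) (0, x)) ∧
        -- after removal of the deterministic term they are continuous on the closed time interval
        ContinuousOn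
          (fun p : ℝ × StochHeat.Space d => u' p.1 p.2 ω - StochHeat.heatInit u₀ p.1 p.2)
          (Set.Icc 0 T ×ˢ Set.univ) := by
  obtain ⟨L, hL⟩ := hbL
  obtain ⟨M, hM⟩ := hbB
  obtain ⟨M₀, hM₀⟩ := hu₀B
  choose V hV hmild using hu.mild
  obtain ⟨Y, hYm, hYV, hYc⟩ :=
    StochHeat.exists_continuous_stochasticConvolution hW hq hμ hT.le hV
  -- `u` is jointly measurable only for times in `[0, T]`; clamping time gives a bounded measurable
  -- integrand on all of `ℝ` that agrees with `b (u s y ω)` where the drift uses it.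
  set F : ℝ → StochHeat.Space d → Ω → ℝ :=
    fun s y ω => b (u (Set.projIcc 0 T hT.le s) y ω) with hF
  have hFm : Measurable fun p : ℝ × StochHeat.Space d × Ω => F p.1 p.2.1 p.2.2 := by
    have h1 : Measurable fun p : ℝ × StochHeat.Space d × Ω =>
        (Set.projIcc 0 T hT.le p.1, p.2.1, p.2.2) :=
      (continuous_projIcc.measurable.comp measurable_fst).prodMk measurable_snd
    exact hL.continuous.measurable.comp (hu.measurable.comp h1)
  set D : ℝ → StochHeat.Space d → Ω → ℝ := fun t x ω =>
    ∫ s in (0 : ℝ)..t, ∫ y, F s y ω * StochHeat.heatKernel (t - s) (x - y) with hD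
  have hDeq : ∀ t ∈ Set.Icc 0 T, ∀ x ω, D t x ω =
      ∫ s in (0 : ℝ)..t, ∫ y, b (u s y ω) * StochHeat.heatKernel (t - s) (x - y) := by
    intro t ht x ω
    refine intervalIntegral.integral_congr fun s hs => ?_
    rw [Set.uIcc_of_le ht.1] at hs
    simp only [hF, Set.projIcc_of_mem hT.le (⟨hs.1, hs.2.trans ht.2⟩ : s ∈ Set.Icc 0 T)]
  have hDc : ∀ ω, ContinuousOn (fun p : ℝ × StochHeat.Space d => D p.1 p.2 ω)
      (Set.Ici 0 ×ˢ Set.univ) := fun ω =>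
    StochHeat.continuousOn_drift (f := fun s y => F s y ω)
      (hFm.comp (f := fun p : ℝ × StochHeat.Space d => (p.1, p.2, ω)) (by fun_prop))
      fun s y => hM _
  have hYD : ∀ ω, ContinuousOn (fun p : ℝ × StochHeat.Space d => Y p.1 p.2 ω + D p.1 p.2 ω)
      (Set.Icc 0 T ×ˢ Set.univ) := fun ω =>
    (hYc ω).continuousOn.add ((hDc ω).mono (Set.prod_mono Set.Icc_subset_Ici_self le_rfl))
  -- Only the stochastic convolution is replaced by a continuous version. Initial term and drift are
  -- kept pathwise, so continuity holds for every `ω`, while equality with `u` holds off a null set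
  -- depending on `(t, x)`.
  refine ⟨fun t x ω => StochHeat.heatInit u₀ t x + (Y t x ω + D t x ω), fun t ht x => ⟨?_, ?_⟩,
    fun ω => ⟨?_, fun x hx => ?_, ?_⟩⟩
  · exact measurable_const.add ((hYm t x).add (StochHeat.measurable_drift hFm t x))
  · filter_upwards [hYV t ht x, hmild t ht x] with ω h1 h2
    rw [h2, h1, hDeq t ht, add_assoc]
  · exact ((StochHeat.continuousOn_heatInit hu₀m hM₀).mono
      (Set.prod_mono Set.Ioc_subset_Ioi_self le_rfl)).add
      ((hYD ω).mono (Set.prod_mono Set.Ioc_subset_Icc_self le_rfl))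
  · exact ((StochHeat.continuousWithinAt_heatInit hu₀m hM₀ hx).mono
      (Set.prod_mono Set.Icc_subset_Ici_self le_rfl)).add
      (hYD ω (0, x) ⟨⟨le_rfl, hT.le⟩, Set.mem_univ _⟩)
  · simpa only [add_sub_cancel_left] using hYD ω
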